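/- Let $n\ge 1$ be an integer, $q\in\mathbb Z/4\mathbb Z$, and $s,\lambda\in\mathbb C$; if $n\ge 2$ assume $\lambda\neq 0$. Let $\|\cdot\|$ be the Euclidean norm and $\Delta_n$ the Laplacian in $y\in\mathbb R^n$, and write $\rho=\|y\|$. Let $$I''(q,-\tfrac n2,s)=\{F\in C^\infty(\mathbb R\times\mathbb R^n;\mathbb C)\ :\ F(\theta+j\pi,(-1)^jy)=i^{-jq}F(\theta,y)\ \text{for all } j\in\mathbb Z\},$$ $$\Omega''=\|y\|^2\left(4s\,\partial_\theta+4s^2\|y\|^2+\Delta_n\right).$$ The group $K=K_2\times O(n)$, where $K_2\cong\mathbb R/4\pi\mathbb Z$, acts by $((\alpha,u).F)(\theta,y)=F(\theta-\alpha,u^{-1}y)$, and $F$ is called $K$-finite if its $K$-translates span a finite-dimensional complex vector space. Let $\ker(\Omega''-2\lambda)_K$ be the space of $K$-finite $F\in I''(q,-\frac n2,s)$ with $\Omega''F=2\lambda F$. Let $\mathcal H_k(\mathbb R^n)$ be the space of complex harmonic polynomials on $\mathbb R^n$ that are homogeneous of degree $k$, and let ${}_1F_1(a,b,z)=\sum_{j\ge0}\frac{(a)_j}{(b)_j\,j!}z^j$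 be the confluent hypergeometric function of the first kind. Call $\lambda$ admissible if - $n=1$ and $\lambda=\frac12L(L-1)$ for some integer $L\ge0$ (a triangular number), or - $n\ge2$ and $\lambda\in A_n=\{l(n+2j)\ :\ l,j\in\mathbb Z,\ 1\le l\le j+1\}$. Call a pair of integers $(l,k)$ with $l,k\ge 0$ $\lambda$-admissible if $\lambda=l(2l+2k+n-2)$ and, in addition, $l\ge1$ when $n\ge2$, and $k\in\{0,1\}$ when $n=1$. (For $n=1$ the equation reads $\lambda=\frac12L(L-1)$ with $L=2l+k$.) Then: 1. $\ker(\Omega''-2\lambda)_K\neq\{0\}$ if and only if $\lambda$ is admissible. 2. If $\lambda$ is admissible, then $\ker(\Omega''-2\lambda)_K$ is the complex linear span of the functions $$F_{m,l,k}(\theta,y)=e^{-im\theta/2}\,e^{-is\rho^2}\,\rho^{2l}\,h_k(y)\;{}_1F_1\!\left(\tfrac{m+4l+2k+n}{4},\,2l+k+\tfrac n2,\,2is\rho^2\right),$$ where $(l,k)$ runs over the $\lambda$-admissible pairs, $h_k$ over $\mathcal H_k(\mathbb R^n)$, and $m$ over the integers with $m\equiv 2k+q \pmod 4$. -/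

import Mathlib

open scoped ContDiff

noncomputable section

namespace SingularSchrodinger

/-- Complex valued functions `F(θ, y)` on `ℝ × ℝⁿ`, where `ℝⁿ` carries the Euclidean norm. -/
abbrev Fn (n : ℕ) : Type := ℝ × EuclideanSpace ℝ (Fin n) → ℂ

/-- The compact picture `I''(q, -n/2, s)`: smooth functions on `ℝ × ℝⁿ` such that
`F(θ + jπ, (-1)^j y) = i^{-jq} F(θ, y)` for all integers `j`.
As a space of functions it does not depend on `s`. -/
def compactPicture (n : ℕ) (q : ZMod 4) : Submodule ℂ (Fn n) where
  carrier := {F | ContDiff ℝ ∞ F ∧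
    ∀ (j : ℤ) (θ : ℝ) (y : EuclideanSpace ℝ (Fin n)),
      F (θ + j * Real.pi, (-1 : ℝ) ^ j • y) = Complex.I ^ (-(j * (q.val : ℤ))) * F (θ, y)}
  zero_mem' := ⟨contDiff_const, fun j θ y => by simp⟩
  add_mem' := by
    rintro F G ⟨hF, hF'⟩ ⟨hG, hG'⟩
    refine ⟨hF.add hG, fun j θ y => ?_⟩
    simp only [Pi.add_apply, hF', hG', mul_add]
  smul_mem' := by
    rintro c F ⟨hF, hF'⟩
    refine ⟨contDiff_const.smul hF, fun j θ y => ?_⟩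
    simp only [Pi.smul_apply, hF', smul_eq_mul]
    ring

/-- The differential operator `Ω'' = ‖y‖² (4s ∂_θ + 4s² ‖y‖² + Δ_n)`. -/
def OmegaOp (n : ℕ) (s : ℂ) (F : Fn n) : Fn n := fun p =>
  ((‖p.2‖ ^ 2 : ℝ) : ℂ) *
    (4 * s * deriv (fun t : ℝ => F (t, p.2)) p.1 +
      4 * s ^ 2 * ((‖p.2‖ ^ 2 : ℝ) : ℂ) * F p +
      Laplacian.laplacian (fun y : EuclideanSpace ℝ (Fin n) => F (p.1, y)) p.2)

theorem contDiff_slice_fst {n : ℕ} {F : Fn n} (hF : ContDiff ℝ ∞ F)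
    (y : EuclideanSpace ℝ (Fin n)) : ContDiff ℝ ∞ (fun t : ℝ => F (t, y)) :=
  hF.comp (contDiff_id.prodMk contDiff_const)

theorem contDiff_slice_snd {n : ℕ} {F : Fn n} (hF : ContDiff ℝ ∞ F) (θ : ℝ) :
    ContDiff ℝ 2 (fun y : EuclideanSpace ℝ (Fin n) => F (θ, y)) :=
  (contDiff_infty.1 hF 2).comp (contDiff_const.prodMk contDiff_id)

theorem OmegaOp_add {n : ℕ} (s : ℂ) {F G : Fn n} (hF : ContDiff ℝ ∞ F) (hG : ContDiff ℝ ∞ G) :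
    OmegaOp n s (F + G) = OmegaOp n s F + OmegaOp n s G := by
  funext p
  have h1 : deriv (fun t : ℝ => F (t, p.2) + G (t, p.2)) p.1
      = deriv (fun t : ℝ => F (t, p.2)) p.1 + deriv (fun t : ℝ => G (t, p.2)) p.1 :=
    deriv_fun_add ((contDiff_slice_fst hF p.2).differentiable (by simp) _)
      ((contDiff_slice_fst hG p.2).differentiable (by simp) _)
  have h2 := ContDiffAt.laplacian_add (contDiff_slice_snd hF p.1).contDiffAt
    (contDiff_slice_snd hG p.1).contDiffAt (x := p.2)
  have h3 : (fun y : EuclideanSpace ℝ (Fin n) => F (p.1, y) + G (p.1, y))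
      = (fun y => F (p.1, y)) + (fun y => G (p.1, y)) := rfl
  simp only [OmegaOp, Pi.add_apply, h1, h3, h2]
  ring

theorem OmegaOp_smul {n : ℕ} (s c : ℂ) {F : Fn n} (hF : ContDiff ℝ ∞ F) :
    OmegaOp n s (c • F) = c • OmegaOp n s F := by
  funext p
  have h1 : deriv (fun t : ℝ => c * F (t, p.2)) p.1
      = c * deriv (fun t : ℝ => F (t, p.2)) p.1 :=
    deriv_const_mul c ((contDiff_slice_fst hF p.2).differentiable (by simp) _)
  have h2 := InnerProductSpace.laplacian_smul c
    (contDiff_slice_snd hF p.1).contDiffAt (x := p.2)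
  have h3 : (fun y : EuclideanSpace ℝ (Fin n) => c * F (p.1, y))
      = c • (fun y => F (p.1, y)) := rfl
  simp only [OmegaOp, Pi.smul_apply, smul_eq_mul, h1, h3, h2]
  ring

/-- `ker (Ω'' - 2λ) ⊂ I''(q, -n/2, s)`. -/
def kerOmega (n : ℕ) (q : ZMod 4) (s lam : ℂ) : Submodule ℂ (Fn n) where
  carrier := {F | F ∈ compactPicture n q ∧ OmegaOp n s F = (2 * lam) • F}
  zero_mem' := by
    refine ⟨Submodule.zero_mem _, ?_⟩
    have h := OmegaOp_smul (n := n) s 0 (F := 0) contDiff_const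
    simpa using h
  add_mem' := by
    rintro F G ⟨hF, hF'⟩ ⟨hG, hG'⟩
    exact ⟨Submodule.add_mem _ hF hG, by rw [OmegaOp_add s hF.1 hG.1, hF', hG', smul_add]⟩
  smul_mem' := by
    rintro c F ⟨hF, hF'⟩
    exact ⟨Submodule.smul_mem _ c hF, by rw [OmegaOp_smul s c hF.1, hF', smul_comm]⟩

/-- The action of `K = K₂ × O(n)`: the rotation of angle `α` in the double cover `K₂` (a circle of
length `4π`) together with `u ∈ O(n)` sends `F` to `(θ, y) ↦ F(θ - α, u⁻¹ y)`. -/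
def kAct (n : ℕ) (α : ℝ) (u : EuclideanSpace ℝ (Fin n) ≃ₗᵢ[ℝ] EuclideanSpace ℝ (Fin n)) :
    Fn n →ₗ[ℂ] Fn n :=
  LinearMap.funLeft ℂ ℂ (fun p : ℝ × EuclideanSpace ℝ (Fin n) => (p.1 - α, u.symm p.2))

/-- The linear span of the `K`-orbit of `F`. -/
def kSpan (n : ℕ) (F : Fn n) : Submodule ℂ (Fn n) :=
  Submodule.span ℂ (Set.range
    (fun g : ℝ × (EuclideanSpace ℝ (Fin n) ≃ₗᵢ[ℝ] EuclideanSpace ℝ (Fin n)) => kAct n g.1 g.2 F))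

/-- `F` is `K`-finite: its `K`-translates span a finite dimensional space. -/
def IsKFinite (n : ℕ) (F : Fn n) : Prop := FiniteDimensional ℂ (kSpan n F)

/-- The space `ker (Ω'' - 2λ)_K` of `K`-finite vectors in `ker (Ω'' - 2λ) ⊂ I''(q, -n/2, s)`. -/
def kerOmegaK (n : ℕ) (q : ZMod 4) (s lam : ℂ) : Submodule ℂ (Fn n) where
  carrier := {F | F ∈ kerOmega n q s lam ∧ IsKFinite n F}
  zero_mem' := by
    refine ⟨Submodule.zero_mem _, ?_⟩
    have h : kSpan n (0 : Fn n) = ⊥ := by simp [kSpan]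
    unfold IsKFinite
    rw [h]
    infer_instance
  add_mem' := by
    rintro F G ⟨hF, hF'⟩ ⟨hG, hG'⟩
    refine ⟨Submodule.add_mem _ hF hG, ?_⟩
    unfold IsKFinite at *
    have h : kSpan n (F + G) ≤ kSpan n F ⊔ kSpan n G := by
      refine Submodule.span_le.2 ?_
      rintro _ ⟨g, rfl⟩
      simp only [map_add]
      exact Submodule.add_mem_sup (Submodule.subset_span ⟨g, rfl⟩) (Submodule.subset_span ⟨g, rfl⟩)
    exact Submodule.finiteDimensional_of_le h
  smul_mem' := by
    rintro c F ⟨hF, hF'⟩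
    refine ⟨Submodule.smul_mem _ c hF, ?_⟩
    unfold IsKFinite at *
    have h : kSpan n (c • F) ≤ kSpan n F := by
      refine Submodule.span_le.2 ?_
      rintro _ ⟨g, rfl⟩
      simp only [map_smul]
      exact Submodule.smul_mem _ c (Submodule.subset_span ⟨g, rfl⟩)
    exact Submodule.finiteDimensional_of_le h

/-- `𝓗_k(ℝⁿ)`: complex homogeneous polynomials of degree `k` in `n` variables that are
annihilated by the Laplacian. -/
def harmonicPoly (n k : ℕ) : Set (MvPolynomial (Fin n) ℂ) :=
  {h | h.IsHomogeneous k ∧ ∑ i, MvPolynomial.pderiv i (MvPolynomial.pderiv i h) = 0}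

/-- Kummer's confluent hypergeometric function of the first kind
`₁F₁(a, b, z) = ∑_j (a)_j / ((b)_j j!) z^j`, for `b` not a nonpositive integer. -/
def kummer (a b z : ℂ) : ℂ :=
  ∑' j : ℕ, (ascPochhammer ℂ j).eval a / ((ascPochhammer ℂ j).eval b * (j.factorial : ℂ)) * z ^ j

/-- The functions `F_{m,l,k}(θ, y) = e^{-imθ/2} e^{-isρ²} ρ^{2l} h(y)
₁F₁((m + 4l + 2k + n)/4, 2l + k + n/2, 2isρ²)`, where `ρ = ‖y‖` and `h` is a polynomial. -/
def Fmlk (n : ℕ) (s : ℂ) (m : ℤ) (l k : ℕ) (h : MvPolynomial (Fin n) ℂ) : Fn n := fun p =>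
  Complex.exp (-(Complex.I * m * p.1) / 2) *
    Complex.exp (-(Complex.I * s * (‖p.2‖ : ℂ) ^ 2)) *
    (‖p.2‖ : ℂ) ^ (2 * l) *
    MvPolynomial.eval (fun i => ((p.2 i : ℝ) : ℂ)) h *
    kummer (((m : ℂ) + 4 * l + 2 * k + n) / 4) (2 * l + k + (n : ℂ) / 2)
      (2 * Complex.I * s * (‖p.2‖ : ℂ) ^ 2)

/-- The set `A_n`: the triangular numbers `l(l-1)/2` if `n = 1`, and
`{l(n + 2j) : l, j ∈ ℤ, 1 ≤ l ≤ j + 1}` if `n ≥ 2`. -/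
def admissibleSet (n : ℕ) : Set ℂ :=
  if n = 1 then {lam | ∃ l : ℕ, lam = (l : ℂ) * ((l : ℂ) - 1) / 2}
  else {lam | ∃ l j : ℤ, 1 ≤ l ∧ l ≤ j + 1 ∧ lam = (l : ℂ) * ((n : ℂ) + 2 * (j : ℂ))}

/-- The pair `(l, k)` is `λ`-admissible: `λ = l(2l + 2k + n - 2)`, where `l ≥ 1` if `n ≥ 2`, while
for `n = 1` one has `l ≥ 0` and `k ∈ {0, 1}`. In the case `n = 1` this says
`λ = L(L-1)/2` with `L = 2l + k`, the order of vanishing of `ρ^{2l} y^k` at `0`. -/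
def IsAdmissiblePair (n : ℕ) (lam : ℂ) (l k : ℕ) : Prop :=
  lam = (l : ℂ) * (2 * (l : ℂ) + 2 * (k : ℂ) + (n : ℂ) - 2) ∧
    (2 ≤ n → 1 ≤ l) ∧ (n = 1 → k ≤ 1)

end SingularSchrodinger

end

open scoped ContDiff

noncomputable section

namespace SingularSchrodinger

open MvPolynomial

/-! ### Polynomial eigenvectors of `‖y‖² Δ`. -/

section HarmonicPolynomials

/-! A `K`-finite function is a finite sum of Fourier components `e^{-imθ/2} f(y)`. Each component is
an average of translates of the function, hence stays in its `K`-span and in the kernel. This leaves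
the equation `‖y‖²((4s²‖y‖² - 2ims) f + Δf) = 2λ f` for a smooth `f` whose rotates span a
finite-dimensional space.

Everything is then read off from the Taylor expansion at the singular point `y = 0`. Let `P` be the
first nonzero homogeneous term of `f`. The terms of lowest order give `‖y‖² ΔP = 2λP`, and dividing
out `‖y‖²` repeatedly shows `P = ‖y‖^{2l} h` with `h` harmonic of degree `k` and `λ = l(2l+2k+n-2)`
(`exists_harmonic_of_normSq_mul_lap`). By Kummer's equation the `y`-part of `Fmlk` solves the same
equation (`solution_pde`), and it has the same leading term, so subtracting it raises the order of
vanishing (`exists_leading_solution`). Admissible pairs have bounded degree `2l + k`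
(`degree_le_of_isAdmissiblePair`), so finitely many subtractions leave a remainder that is flat at
the origin.

A flat remainder is zero (`eq_zero_of_flat`). Along a ray, invariance and finite dimension express
the angular second derivatives through the functions themselves with constant coefficients. The
equation becomes a system `r p' = A(r) p` with bounded `A`, whose flat solutions vanish by a
Gronwall argument. No expansion in spherical harmonics is needed.

Conversely, an admissible `λ` has an admissible pair, and a nonzero harmonic polynomial of that
degree gives a nonzero `Fmlk`. -/

/-- The polynomial `∑ Xᵢ²`. -/
def normSqPoly (n : ℕ) : MvPolynomial (Fin n) ℂ := ∑ i, X i ^ 2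

/-- The Laplacian on polynomials. -/
def lapPoly {n : ℕ} (P : MvPolynomial (Fin n) ℂ) : MvPolynomial (Fin n) ℂ :=
  ∑ i, pderiv i (pderiv i P)

theorem isHomogeneous_normSqPoly (n : ℕ) : (normSqPoly n).IsHomogeneous 2 :=
  IsHomogeneous.sum _ _ _ fun i _ => isHomogeneous_X_pow i 2

theorem isHomogeneous_lapPoly {n d : ℕ} {P : MvPolynomial (Fin n) ℂ} (hP : P.IsHomogeneous d) :
    (lapPoly P).IsHomogeneous (d - 2) :=
  IsHomogeneous.sum _ _ _ fun _ _ => hP.pderiv.pderiv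

theorem isHomogeneous_smul {n d : ℕ} {P : MvPolynomial (Fin n) ℂ} (c : ℂ)
    (hP : P.IsHomogeneous d) : (c • P).IsHomogeneous d := by
  rw [smul_eq_C_mul]
  exact hP.C_mul c

theorem normSqPoly_ne_zero {n : ℕ} (hn : 1 ≤ n) : normSqPoly n ≠ 0 := by
  intro h
  have h2 := congrArg (MvPolynomial.eval (fun _ => (1 : ℂ))) h
  simp [normSqPoly] at h2
  omega

theorem pderiv_normSqPoly {n : ℕ} (i : Fin n) : pderiv i (normSqPoly n) = 2 * X i := by
  classical
  simp only [normSqPoly, map_sum, Derivation.leibniz_pow, pderiv_X]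
  rw [Finset.sum_eq_single i]
  · simp
  · intro b _ hb
    simp [hb]
  · simp

/-- Leibniz rule: the cross term is `4 ∑ Xᵢ ∂ᵢQ`, which Euler's identity evaluates to `4d Q`. -/
theorem lapPoly_normSqPoly_mul {n d : ℕ} {Q : MvPolynomial (Fin n) ℂ} (hQ : Q.IsHomogeneous d) :
    lapPoly (normSqPoly n * Q) = (2 * (n : ℂ) + 4 * d) • Q + normSqPoly n * lapPoly Q := by
  have h1 : ∀ i : Fin n, pderiv i (pderiv i (normSqPoly n * Q)) =
      2 * Q + 4 * (X i * pderiv i Q) + normSqPoly n * pderiv i (pderiv i Q) := by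
    intro i
    have h2 : pderiv i (2 : MvPolynomial (Fin n) ℂ) = 0 := by
      have h3 := pderiv_C (R := ℂ) (i := i) (a := 2)
      rwa [map_ofNat] at h3
    simp only [Derivation.leibniz, map_add, pderiv_normSqPoly, smul_eq_mul, h2, pderiv_X_self]
    ring
  simp only [lapPoly, h1, Finset.sum_add_distrib, ← Finset.mul_sum, hQ.sum_X_mul_pderiv]
  simp only [Finset.sum_const, Finset.card_univ, Fintype.card_fin, nsmul_eq_mul, smul_eq_C_mul]
  simp only [map_add, map_mul, map_ofNat, map_natCast]
  ring

/-- A homogeneous polynomial eigenvector of `‖y‖² Δ` is a power of `‖y‖²` times a harmonic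
polynomial. -/
theorem exists_harmonic_of_normSq_mul_lap {n : ℕ} (hn : 1 ≤ n) (d : ℕ) :
    ∀ (ν : ℂ) (P : MvPolynomial (Fin n) ℂ), P.IsHomogeneous d → P ≠ 0 →
      normSqPoly n * lapPoly P = ν • P →
      ∃ (l k : ℕ) (h : MvPolynomial (Fin n) ℂ), d = 2 * l + k ∧ h ∈ harmonicPoly n k ∧
        P = normSqPoly n ^ l * h ∧
        ν = 2 * ((l : ℂ) * (2 * (l : ℂ) + 2 * (k : ℂ) + (n : ℂ) - 2)) := by
  induction d using Nat.strong_induction_on with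
  | _ d ih =>
    intro ν P hP hP0 h
    by_cases hν : ν = 0
    · refine ⟨0, d, P, by simp, ⟨hP, ?_⟩, by simp, by simp [hν]⟩
      change lapPoly P = 0
      simpa [hν, normSqPoly_ne_zero hn] using h
    -- For `ν ≠ 0` the equation itself exhibits `P` as `‖y‖² Q`. The quotient solves the same
    -- equation with `ν` lowered by `2n + 4(d - 2)`, so the induction descends by two degrees.
    · set Q := ν⁻¹ • lapPoly P with hQ
      have hPQ : P = normSqPoly n * Q := by
        rw [hQ, mul_smul_comm, h, smul_smul, inv_mul_cancel₀ hν, one_smul]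
      have hQ0 : Q ≠ 0 := by
        rintro h0
        rw [h0, mul_zero] at hPQ
        exact hP0 hPQ
      have hQd : Q.IsHomogeneous (d - 2) := isHomogeneous_smul _ (isHomogeneous_lapPoly hP)
      -- This excludes truncation in `d - 2`: a nonzero homogeneous polynomial has only one degree,
      -- and the factorisation gives it degree `2 + (d - 2)`.
      have hd : d = 2 + (d - 2) := by
        refine hP.inj_right ?_ hP0
        conv_lhs => rw [hPQ]
        exact (isHomogeneous_normSqPoly n).mul hQd
      have heq : normSqPoly n * lapPoly Q = (ν - (2 * (n : ℂ) + 4 * ((d - 2 : ℕ) : ℂ))) • Q := by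
        have h3 : ν • Q = lapPoly P := by
          rw [hQ, smul_smul, mul_inv_cancel₀ hν, one_smul]
        rw [hPQ, lapPoly_normSqPoly_mul hQd] at h3
        rw [sub_smul, h3]
        abel
      obtain ⟨l, k, p, hlk, hp, hQp, hνp⟩ := ih (d - 2) (by omega) _ Q hQd hQ0 heq
      refine ⟨l + 1, k, p, by omega, hp, ?_, ?_⟩
      · rw [hPQ, hQp, pow_succ]
        ring
      · rw [hlk] at hνp
        push_cast at hνp ⊢
        linear_combination hνp

end HarmonicPolynomials

/-! ### Order of vanishing at the origin and leading Taylor polynomials. -/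

section VanishingOrder

/-- The partial derivative in the direction of the `i`-th basis vector. -/
def partialDeriv {n : ℕ} (i : Fin n) (f : EuclideanSpace ℝ (Fin n) → ℂ) :
    EuclideanSpace ℝ (Fin n) → ℂ :=
  fun y => fderiv ℝ f y (EuclideanSpace.single i 1)

/-- A polynomial as a function on `ℝⁿ`. -/
def polyFun {n : ℕ} (P : MvPolynomial (Fin n) ℂ) : EuclideanSpace ℝ (Fin n) → ℂ :=
  fun y => MvPolynomial.eval (fun i => ((y i : ℝ) : ℂ)) P

/-- All derivatives of `f` of order less than `N` vanish at the origin. -/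
def VanishesToOrder {n : ℕ} : ℕ → (EuclideanSpace ℝ (Fin n) → ℂ) → Prop
  | 0, _ => True
  | N + 1, f => f 0 = 0 ∧ ∀ i, VanishesToOrder N (partialDeriv i f)

variable {n : ℕ} {f g : EuclideanSpace ℝ (Fin n) → ℂ}

theorem contDiff_partialDeriv (hf : ContDiff ℝ ∞ f) (i : Fin n) :
    ContDiff ℝ ∞ (partialDeriv i f) :=
  (hf.fderiv_right (m := ∞) (by simp)).clm_apply contDiff_const

theorem differentiable_of_contDiff (hf : ContDiff ℝ ∞ f) : Differentiable ℝ f :=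
  hf.differentiable (by simp)

theorem partialDeriv_add (hf : ContDiff ℝ ∞ f) (hg : ContDiff ℝ ∞ g) (i : Fin n) :
    partialDeriv i (f + g) = partialDeriv i f + partialDeriv i g := by
  funext y
  simp only [partialDeriv, Pi.add_apply]
  rw [fderiv_add (differentiable_of_contDiff hf y) (differentiable_of_contDiff hg y)]
  rfl

theorem partialDeriv_sub (hf : ContDiff ℝ ∞ f) (hg : ContDiff ℝ ∞ g) (i : Fin n) :
    partialDeriv i (f - g) = partialDeriv i f - partialDeriv i g := by
  funext y
  simp only [partialDeriv, Pi.sub_apply]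
  rw [fderiv_sub (differentiable_of_contDiff hf y) (differentiable_of_contDiff hg y)]
  rfl

theorem partialDeriv_smul (hf : ContDiff ℝ ∞ f) (c : ℂ) (i : Fin n) :
    partialDeriv i (c • f) = c • partialDeriv i f := by
  funext y
  simp only [partialDeriv, Pi.smul_apply]
  rw [fderiv_const_smul (differentiable_of_contDiff hf y)]
  rfl

theorem partialDeriv_mul (hf : ContDiff ℝ ∞ f) (hg : ContDiff ℝ ∞ g) (i : Fin n) :
    partialDeriv i (f * g) = partialDeriv i f * g + f * partialDeriv i g := by
  funext y
  simp only [partialDeriv, Pi.add_apply, Pi.mul_apply]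
  rw [fderiv_mul (differentiable_of_contDiff hf y) (differentiable_of_contDiff hg y)]
  simp
  ring

theorem differentiable_fderiv (hf : ContDiff ℝ ∞ f) : Differentiable ℝ (fderiv ℝ f) :=
  (hf.fderiv_right (m := ∞) (by simp)).differentiable (by simp)

theorem partialDeriv_partialDeriv (hf : ContDiff ℝ ∞ f) (i j : Fin n)
    (y : EuclideanSpace ℝ (Fin n)) :
    partialDeriv i (partialDeriv j f) y =
      fderiv ℝ (fderiv ℝ f) y (EuclideanSpace.single i 1) (EuclideanSpace.single j 1) := by
  have h : HasFDerivAt (partialDeriv j f) _ y :=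
    (differentiable_fderiv hf y).hasFDerivAt.clm_apply
      (hasFDerivAt_const (EuclideanSpace.single j (1 : ℝ)) y)
  rw [partialDeriv, h.fderiv]
  simp

theorem partialDeriv_comm (hf : ContDiff ℝ ∞ f) (i j : Fin n) :
    partialDeriv i (partialDeriv j f) = partialDeriv j (partialDeriv i f) := by
  funext y
  rw [partialDeriv_partialDeriv hf, partialDeriv_partialDeriv hf]
  exact ((contDiff_infty.1 hf 2).contDiffAt.isSymmSndFDerivAt (by simp)) _ _

theorem laplacian_eq_sum_partialDeriv (hf : ContDiff ℝ ∞ f) :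
    Laplacian.laplacian f = ∑ i, partialDeriv i (partialDeriv i f) := by
  rw [InnerProductSpace.laplacian_eq_iteratedFDeriv_orthonormalBasis f
    (EuclideanSpace.basisFun (Fin n) ℝ)]
  funext y
  rw [Finset.sum_apply]
  refine Finset.sum_congr rfl fun i _ => ?_
  rw [partialDeriv_partialDeriv hf, iteratedFDeriv_two_apply]
  simp

theorem contDiff_laplacian (hf : ContDiff ℝ ∞ f) : ContDiff ℝ ∞ (Laplacian.laplacian f) := by
  rw [laplacian_eq_sum_partialDeriv hf, Finset.sum_fn]
  exact ContDiff.sum fun i _ => contDiff_partialDeriv (contDiff_partialDeriv hf i) i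

theorem fderiv_eq_sum_partialDeriv (y v : EuclideanSpace ℝ (Fin n)) :
    fderiv ℝ f y v = ∑ i, (v i : ℂ) * partialDeriv i f y := by
  conv_lhs => rw [← (EuclideanSpace.basisFun (Fin n) ℝ).sum_repr v]
  simp [partialDeriv]

theorem norm_fderiv_le_sum_partialDeriv (y : EuclideanSpace ℝ (Fin n)) :
    ‖fderiv ℝ f y‖ ≤ ∑ i, ‖partialDeriv i f y‖ := by
  refine ContinuousLinearMap.opNorm_le_bound _ (Finset.sum_nonneg fun _ _ => norm_nonneg _) ?_
  intro v
  rw [fderiv_eq_sum_partialDeriv, Finset.sum_mul]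
  refine (norm_sum_le _ _).trans (Finset.sum_le_sum fun i _ => ?_)
  rw [norm_mul, mul_comm]
  gcongr
  simpa using PiLp.norm_apply_le v i

namespace VanishesToOrder

theorem of_succ {N : ℕ} (h : VanishesToOrder (N + 1) f) : VanishesToOrder N f := by
  induction N generalizing f with
  | zero => trivial
  | succ N ih => exact ⟨h.1, fun i => ih (h.2 i)⟩

theorem mono {M N : ℕ} (hMN : M ≤ N) (h : VanishesToOrder N f) : VanishesToOrder M f := by
  induction hMN with
  | refl => exact h
  | step _ ih => exact ih h.of_succ

theorem add (hf : ContDiff ℝ ∞ f) (hg : ContDiff ℝ ∞ g) {N : ℕ} (h : VanishesToOrder N f)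
    (h' : VanishesToOrder N g) : VanishesToOrder N (f + g) := by
  induction N generalizing f g with
  | zero => trivial
  | succ N ih =>
    refine ⟨by simp [h.1, h'.1], fun i => ?_⟩
    rw [partialDeriv_add hf hg]
    exact ih (contDiff_partialDeriv hf i) (contDiff_partialDeriv hg i) (h.2 i) (h'.2 i)

theorem smul (hf : ContDiff ℝ ∞ f) (c : ℂ) {N : ℕ} (h : VanishesToOrder N f) :
    VanishesToOrder N (c • f) := by
  induction N generalizing f with
  | zero => trivial
  | succ N ih =>
    refine ⟨by simp [h.1], fun i => ?_⟩
    rw [partialDeriv_smul hf]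
    exact ih (contDiff_partialDeriv hf i) (h.2 i)

theorem sub (hf : ContDiff ℝ ∞ f) (hg : ContDiff ℝ ∞ g) {N : ℕ} (h : VanishesToOrder N f)
    (h' : VanishesToOrder N g) : VanishesToOrder N (f - g) := by
  have h1 : f - g = f + (-1 : ℂ) • g := by simp [sub_eq_add_neg]
  rw [h1]
  exact h.add hf (contDiff_const.smul hg) (h'.smul hg (-1))

/-- Induction on the total order: in the Leibniz rule, differentiation costs one order in one
factor. If the differentiated factor has order `0` and so none to lose, the order claimed for the
other factor is lowered instead. -/
theorem mul (hf : ContDiff ℝ ∞ f) (hg : ContDiff ℝ ∞ g) {M N : ℕ} (h : VanishesToOrder M f)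
    (h' : VanishesToOrder N g) : VanishesToOrder (M + N) (f * g) := by
  induction hk : M + N generalizing f g M N with
  | zero => trivial
  | succ k ih =>
    constructor
    · rcases M with _ | M
      · rcases N with _ | N
        · omega
        · simp [h'.1]
      · simp [h.1]
    · intro i
      rw [partialDeriv_mul hf hg]
      refine VanishesToOrder.add ((contDiff_partialDeriv hf i).mul hg)
        (hf.mul (contDiff_partialDeriv hg i)) ?_ ?_
      · rcases M with _ | M
        · exact (ih (M := 0) (N := N - 1) (contDiff_partialDeriv hf i) hg trivial
            (h'.mono (by omega)) (by omega))
        · exact ih (contDiff_partialDeriv hf i) hg (h.2 i) h' (by omega)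
      · rcases N with _ | N
        · exact (ih (M := M - 1) (N := 0) hf (contDiff_partialDeriv hg i)
            (h.mono (by omega)) trivial (by omega))
        · exact ih hf (contDiff_partialDeriv hg i) h (h'.2 i) (by omega)

theorem sum {ι : Type*} (s : Finset ι) {F : ι → EuclideanSpace ℝ (Fin n) → ℂ}
    (hF : ∀ i, ContDiff ℝ ∞ (F i)) {N : ℕ} (h : ∀ i, VanishesToOrder N (F i)) :
    VanishesToOrder N (∑ i ∈ s, F i) := by
  classical
  induction s using Finset.induction_on with
  | empty =>
    have h0 : VanishesToOrder N ((0 : ℂ) • (fun _ => 0 : EuclideanSpace ℝ (Fin n) → ℂ)) := by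
      clear h
      induction N with
      | zero => trivial
      | succ N ih =>
        refine ⟨by simp, fun i => ?_⟩
        rw [partialDeriv_smul contDiff_const]
        convert ih using 1
        simp
    simpa using h0
  | insert a s ha ih =>
    rw [Finset.sum_insert ha]
    refine (h a).add (hF a) ?_ ih
    rw [Finset.sum_fn]
    exact ContDiff.sum fun i _ => hF i

theorem laplacian (hf : ContDiff ℝ ∞ f) {N : ℕ} (h : VanishesToOrder (N + 2) f) :
    VanishesToOrder N (Laplacian.laplacian f) := by
  rw [laplacian_eq_sum_partialDeriv hf]
  exact VanishesToOrder.sum _ (fun i => contDiff_partialDeriv (contDiff_partialDeriv hf i) i)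
    fun i => (h.2 i).2 i

/-- A smooth function vanishing to order `N` at the origin is `O(‖y‖ᴺ)` on every ball. -/
theorem bound (hf : ContDiff ℝ ∞ f) {N : ℕ} (h : VanishesToOrder N f) (R : ℝ) :
    ∃ C, 0 ≤ C ∧ ∀ y, ‖y‖ ≤ R → ‖f y‖ ≤ C * ‖y‖ ^ N := by
  induction N generalizing f with
  | zero =>
    obtain ⟨C, hC⟩ := (isCompact_closedBall (0 : EuclideanSpace ℝ (Fin n))
      R).exists_bound_of_continuousOn hf.continuous.continuousOn
    refine ⟨max C 0, le_max_right _ _, fun y hy => ?_⟩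
    have := hC y (by simpa using hy)
    simpa using Or.inl this
  | succ N ih =>
    choose C hC0 hC using fun i => ih (contDiff_partialDeriv hf i) (h.2 i)
    refine ⟨∑ i, C i, Finset.sum_nonneg fun i _ => hC0 i, fun y hy => ?_⟩
    -- The derivative is bounded on the ball of radius `‖y‖`, not `R`; the mean value inequality
    -- from `0` to `y` then supplies the extra factor `‖y‖`.
    have hb : ∀ z ∈ Metric.closedBall (0 : EuclideanSpace ℝ (Fin n)) ‖y‖,
        ‖fderiv ℝ f z‖ ≤ (∑ i, C i) * ‖y‖ ^ N := by
      intro z hz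
      rw [mem_closedBall_zero_iff] at hz
      refine (norm_fderiv_le_sum_partialDeriv z).trans ?_
      rw [Finset.sum_mul]
      refine Finset.sum_le_sum fun i _ => (hC i z (hz.trans hy)).trans ?_
      have := hC0 i
      gcongr
    have := (convex_closedBall (0 : EuclideanSpace ℝ (Fin n))
      ‖y‖).norm_image_sub_le_of_norm_fderiv_le (fun z _ => differentiable_of_contDiff hf z) hb (x := 0) (y := y) (by simp) (by simp)
    rw [h.1, sub_zero, sub_zero] at this
    rw [pow_succ, ← mul_assoc]
    exact this

end VanishesToOrder

theorem polyFun_apply (P : MvPolynomial (Fin n) ℂ) (y : EuclideanSpace ℝ (Fin n)) :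
    polyFun P y = MvPolynomial.eval (fun i => ((y i : ℝ) : ℂ)) P := rfl

theorem polyFun_add (P Q : MvPolynomial (Fin n) ℂ) : polyFun (P + Q) = polyFun P + polyFun Q := by
  funext y; simp [polyFun]

theorem polyFun_sub (P Q : MvPolynomial (Fin n) ℂ) : polyFun (P - Q) = polyFun P - polyFun Q := by
  funext y; simp [polyFun]

theorem polyFun_mul (P Q : MvPolynomial (Fin n) ℂ) : polyFun (P * Q) = polyFun P * polyFun Q := by
  funext y; simp [polyFun]

theorem polyFun_smul (c : ℂ) (P : MvPolynomial (Fin n) ℂ) : polyFun (c • P) = c • polyFun P := by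
  funext y; simp [polyFun, smul_eq_C_mul]

theorem polyFun_zero : polyFun (0 : MvPolynomial (Fin n) ℂ) = 0 := by
  funext y; simp [polyFun]

theorem polyFun_sum {ι : Type*} (s : Finset ι) (P : ι → MvPolynomial (Fin n) ℂ) :
    polyFun (∑ i ∈ s, P i) = ∑ i ∈ s, polyFun (P i) := by
  funext y; simp [polyFun]

theorem polyFun_C (c : ℂ) : polyFun (C c : MvPolynomial (Fin n) ℂ) = fun _ => c := by
  funext y; simp [polyFun]

theorem polyFun_X (i : Fin n) :
    polyFun (X i : MvPolynomial (Fin n) ℂ) = fun y => ((y i : ℝ) : ℂ) := by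
  funext y; simp [polyFun]

theorem polyFun_normSqPoly : polyFun (normSqPoly n) = fun y => ((‖y‖ ^ 2 : ℝ) : ℂ) := by
  funext y
  simp [polyFun, normSqPoly, EuclideanSpace.norm_sq_eq]

theorem contDiff_polyFun (P : MvPolynomial (Fin n) ℂ) : ContDiff ℝ ∞ (polyFun P) := by
  induction P using MvPolynomial.induction_on with
  | C a => rw [polyFun_C]; exact contDiff_const
  | add p q hp hq => rw [polyFun_add]; exact hp.add hq
  | mul_X p i hp =>
    rw [polyFun_mul, polyFun_X]
    refine hp.mul ?_
    exact Complex.ofRealCLM.contDiff.comp (EuclideanSpace.proj (𝕜 := ℝ) i).contDiff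

theorem partialDeriv_coord (i j : Fin n) :
    partialDeriv i (fun y : EuclideanSpace ℝ (Fin n) => ((y j : ℝ) : ℂ)) =
      fun _ => if j = i then 1 else 0 := by
  funext y
  have h := (Complex.ofRealCLM.comp
    (EuclideanSpace.proj j : EuclideanSpace ℝ (Fin n) →L[ℝ] ℝ)).hasFDerivAt (x := y)
  have h2 : fderiv ℝ (fun y : EuclideanSpace ℝ (Fin n) => ((y j : ℝ) : ℂ)) y = _ := h.fderiv
  simp only [partialDeriv]
  rw [h2]
  by_cases hij : j = i <;> simp [hij]

theorem partialDeriv_polyFun (i : Fin n) (P : MvPolynomial (Fin n) ℂ) :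
    partialDeriv i (polyFun P) = polyFun (pderiv i P) := by
  classical
  induction P using MvPolynomial.induction_on with
  | C a =>
    rw [polyFun_C, pderiv_C, polyFun_zero]
    funext y
    simp [partialDeriv]
  | add p q hp hq =>
    rw [polyFun_add, partialDeriv_add (contDiff_polyFun p) (contDiff_polyFun q), hp, hq, map_add,
      polyFun_add]
  | mul_X p j hp =>
    rw [polyFun_mul, partialDeriv_mul (contDiff_polyFun p) (contDiff_polyFun _), hp, polyFun_X,
      partialDeriv_coord]
    funext y
    simp [polyFun, Derivation.leibniz, pderiv_X, Pi.single_apply, apply_ite]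
    split_ifs <;> ring_nf

theorem laplacian_polyFun (P : MvPolynomial (Fin n) ℂ) :
    Laplacian.laplacian (polyFun P) = polyFun (lapPoly P) := by
  rw [laplacian_eq_sum_partialDeriv (contDiff_polyFun P)]
  simp only [partialDeriv_polyFun, lapPoly, polyFun_sum]

theorem polyFun_injective {P Q : MvPolynomial (Fin n) ℂ} (h : polyFun P = polyFun Q) : P = Q := by
  refine MvPolynomial.funext_set (fun _ => Set.range ((↑) : ℝ → ℂ))
    (fun _ => Set.infinite_range_of_injective Complex.ofReal_injective) fun x hx => ?_
  choose y hy using fun i => hx i (Set.mem_univ i)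
  have h1 := congrFun h (WithLp.toLp 2 y)
  simp only [polyFun] at h1
  have h2 : x = fun i => ((y i : ℝ) : ℂ) := funext fun i => (hy i).symm
  rw [h2]
  exact h1

theorem polyFun_real_smul {d : ℕ} {P : MvPolynomial (Fin n) ℂ} (hP : P.IsHomogeneous d) (t : ℝ)
    (y : EuclideanSpace ℝ (Fin n)) : polyFun P (t • y) = (t : ℂ) ^ d * polyFun P y := by
  simp only [polyFun, MvPolynomial.eval_eq', Finset.mul_sum]
  refine Finset.sum_congr rfl fun m hm => ?_
  have hdeg : ∑ i, m i = d := by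
    have := hP.degree_eq_sum_deg_support hm
    rw [this, Finset.sum_subset (Finset.subset_univ m.support)]
    intro i _ hi
    simpa using hi
  simp only [PiLp.smul_apply, smul_eq_mul, Complex.ofReal_mul, mul_pow, Finset.prod_mul_distrib,
    Finset.prod_pow_eq_pow_sum, hdeg]
  ring

theorem vanishesToOrder_polyFun {d : ℕ} {P : MvPolynomial (Fin n) ℂ} (hP : P.IsHomogeneous d) :
    VanishesToOrder d (polyFun P) := by
  induction d generalizing P with
  | zero => trivial
  | succ d ih =>
    constructor
    · have := polyFun_real_smul hP 0 0
      simpa using this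
    · intro i
      rw [partialDeriv_polyFun]
      exact ih hP.pderiv

/-- Along the segment `t • y`, homogeneity gives `t^d ‖P(y)‖ ≤ C ‖y‖^{d+1} t^{d+1}`; divide by `t^d`
and let `t → 0`. -/
theorem eq_zero_of_vanishesToOrder {d : ℕ} {P : MvPolynomial (Fin n) ℂ} (hP : P.IsHomogeneous d)
    (h : VanishesToOrder (d + 1) (polyFun P)) : P = 0 := by
  refine polyFun_injective ?_
  rw [polyFun_zero]
  funext y
  obtain ⟨C, hC0, hC⟩ := h.bound (contDiff_polyFun P) ‖y‖
  have h1 : ∀ t : ℝ, 0 < t → t ≤ 1 → ‖polyFun P y‖ ≤ (C * ‖y‖ ^ (d + 1)) * t := by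
    intro t ht ht1
    have h2 := hC (t • y) (by
      rw [norm_smul, Real.norm_of_nonneg ht.le]
      exact mul_le_of_le_one_left (norm_nonneg _) ht1)
    rw [polyFun_real_smul hP, norm_mul, norm_pow, Complex.norm_real, norm_smul,
      Real.norm_of_nonneg ht.le, mul_pow, pow_succ t] at h2
    have h3 : 0 < t ^ d := pow_pos ht d
    refine le_of_mul_le_mul_left (h2.trans (le_of_eq ?_)) h3
    ring
  have h4 : ‖polyFun P y‖ ≤ 0 := by
    have hlim : Filter.Tendsto (fun t : ℝ => (C * ‖y‖ ^ (d + 1)) * t) (nhdsWithin 0 (Set.Ioi 0))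
        (nhds ((C * ‖y‖ ^ (d + 1)) * 0)) :=
      ((continuous_const.mul continuous_id).tendsto 0).mono_left nhdsWithin_le_nhds
    rw [mul_zero] at hlim
    refine ge_of_tendsto hlim ?_
    filter_upwards [Ioc_mem_nhdsGT (zero_lt_one' ℝ)] with t ht using h1 t ht.1 ht.2
  simpa using h4

/-- The leading Taylor polynomial of a smooth function vanishing to order `N`. -/
theorem exists_leading_polynomial (hf : ContDiff ℝ ∞ f) {N : ℕ} (h : VanishesToOrder N f) :
    ∃ P : MvPolynomial (Fin n) ℂ, P.IsHomogeneous N ∧ VanishesToOrder (N + 1) (f - polyFun P) := by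
  induction N generalizing f with
  | zero =>
    refine ⟨C (f 0), isHomogeneous_C _ _, ?_, fun i => trivial⟩
    simp [polyFun_C]
  | succ N ih =>
    choose Q hQ hQv using fun i => ih (contDiff_partialDeriv hf i) (h.2 i)
    -- The leading polynomials `Q i` of the partial derivatives must form a closed field. The
    -- difference of the two sides is homogeneous, and by symmetry of second derivatives it is a
    -- difference of remainders, which vanish to higher order. Constant `Q i` are treated apart.
    have hsymm : ∀ i j, pderiv j (Q i) = pderiv i (Q j) := by
      intro i j
      rcases N with _ | N
      · have hc : ∀ i j, pderiv j (Q i) = 0 := by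
          intro i j
          rw [totalDegree_eq_zero_iff_eq_C.1 ((totalDegree_zero_iff_isHomogeneous _).2 (hQ i)),
            pderiv_C]
        rw [hc, hc]
      rw [← sub_eq_zero]
      refine eq_zero_of_vanishesToOrder ((hQ i).pderiv.sub (hQ j).pderiv) ?_
      have h1 : ∀ i j, VanishesToOrder (N + 1)
          (partialDeriv j (partialDeriv i f) - polyFun (pderiv j (Q i))) := by
        intro i j
        have := (hQv i).2 j
        rwa [partialDeriv_sub (contDiff_partialDeriv hf i) (contDiff_polyFun _),
          partialDeriv_polyFun] at this
      have hcd : ∀ i j, ContDiff ℝ ∞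
          (partialDeriv j (partialDeriv i f) - polyFun (pderiv j (Q i))) := fun i j =>
        (contDiff_partialDeriv (contDiff_partialDeriv hf i) j).sub (contDiff_polyFun _)
      have h2 := (h1 j i).sub (hcd j i) (hcd i j) (h1 i j)
      have h3 : polyFun (pderiv j (Q i) - pderiv i (Q j)) =
          partialDeriv i (partialDeriv j f) - polyFun (pderiv i (Q j)) -
            (partialDeriv j (partialDeriv i f) - polyFun (pderiv j (Q i))) := by
        rw [polyFun_sub, partialDeriv_comm hf i j]
        abel
      rw [h3]
      exact h2
    -- The homogeneous Poincaré lemma: by closedness and Euler's identity this `P` has gradient `Q`.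
    set P : MvPolynomial (Fin n) ℂ := ((N : ℂ) + 1)⁻¹ • ∑ i, X i * Q i with hP
    have hder : ∀ j, pderiv j P = Q j := by
      intro j
      classical
      have h1 : pderiv j (∑ i, X i * Q i) = ((N : ℂ) + 1) • Q j := by
        simp only [map_sum, Derivation.leibniz, pderiv_X, smul_eq_mul, Finset.sum_add_distrib]
        rw [Finset.sum_congr rfl fun i _ => by rw [hsymm i j], (hQ j).sum_X_mul_pderiv]
        simp [Pi.single_apply, add_smul, Nat.cast_smul_eq_nsmul]
      rw [hP, Derivation.map_smul, h1, smul_smul,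
        inv_mul_cancel₀ (by exact_mod_cast Nat.succ_ne_zero N), one_smul]
    refine ⟨P, isHomogeneous_smul _ (IsHomogeneous.sum _ _ _ fun i _ => ?_), ?_, fun j => ?_⟩
    · rw [add_comm]
      exact (isHomogeneous_X _ i).mul (hQ i)
    · simp [h.1, hP, polyFun_smul, polyFun_sum, polyFun_mul, polyFun_X]
    · rw [partialDeriv_sub hf (contDiff_polyFun P), partialDeriv_polyFun, hder]
      exact hQv j

end VanishingOrder

/-! ### Kummer's function as an entire power series. -/

section Kummer

/-- The coefficients of an entire power series. -/
def IsEntireSeq (c : ℕ → ℂ) : Prop := ∀ R : ℝ, Summable fun j => ‖c j‖ * R ^ j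

/-- The coefficients of the derivative of a power series. -/
def derivSeq (c : ℕ → ℂ) : ℕ → ℂ := fun j => (j + 1) * c (j + 1)

theorem IsEntireSeq.summable {c : ℕ → ℂ} (hc : IsEntireSeq c) (z : ℂ) :
    Summable fun j => c j * z ^ j := by
  refine Summable.of_norm ?_
  simpa using hc ‖z‖

theorem IsEntireSeq.summable_nat_mul {c : ℕ → ℂ} (hc : IsEntireSeq c) {R : ℝ} (hR : 1 ≤ R) :
    Summable fun j : ℕ => (j : ℝ) * ‖c j‖ * R ^ j := by
  refine Summable.of_nonneg_of_le (fun j => by positivity) (fun j => ?_) (hc (2 * R))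
  have h2 : (j : ℝ) ≤ 2 ^ j := by exact_mod_cast Nat.lt_two_pow_self.le
  rw [mul_pow]
  have h3 : 0 ≤ ‖c j‖ * R ^ j := by positivity
  nlinarith

theorem IsEntireSeq.derivSeq {c : ℕ → ℂ} (hc : IsEntireSeq c) : IsEntireSeq (derivSeq c) := by
  intro R
  have h1 := (summable_nat_add_iff 1).2
    (hc.summable_nat_mul (R := max |R| 1) (le_max_right _ _))
  refine Summable.of_norm (Summable.of_nonneg_of_le (fun j => norm_nonneg _) (fun j => ?_) h1)
  have h2 : |R| ^ j ≤ (max |R| 1) ^ (j + 1) := by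
    calc |R| ^ j ≤ (max |R| 1) ^ j := by gcongr; exact le_max_left _ _
      _ ≤ _ := pow_le_pow_right₀ (le_max_right _ _) (Nat.le_succ j)
  have h3 : ‖((j : ℂ) + 1)‖ = (j : ℝ) + 1 := by
    have : ((j : ℂ) + 1) = ((j + 1 : ℕ) : ℂ) := by push_cast; rfl
    rw [this, Complex.norm_natCast]
    push_cast; rfl
  simp only [SingularSchrodinger.derivSeq, norm_mul, h3, norm_pow, Real.norm_eq_abs, abs_norm,
    Nat.cast_add, Nat.cast_one]
  have h4 : |((j : ℝ) + 1)| = j + 1 := abs_of_nonneg (by positivity)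
  gcongr
  simp [h4]

theorem IsEntireSeq.hasDerivAt {c : ℕ → ℂ} (hc : IsEntireSeq c) (z : ℂ) :
    HasDerivAt (fun w => ∑' j, c j * w ^ j) (∑' j, SingularSchrodinger.derivSeq c j * z ^ j) z := by
  set R : ℝ := ‖z‖ + 1 with hR
  have hR1 : 1 ≤ R := by have := norm_nonneg z; linarith
  have hd : HasDerivAt (fun w => ∑' j, c j * w ^ j) (∑' j : ℕ, c j * (j * z ^ (j - 1))) z := by
    refine hasDerivAt_tsum_of_isPreconnected (hc.summable_nat_mul hR1)
      (Metric.isOpen_ball (x := (0 : ℂ)) (ε := R)) (convex_ball _ _).isPreconnected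
      (fun j w _ => (hasDerivAt_pow j w).const_mul (c j)) (fun j w hw => ?_)
      (y₀ := 0) (by simp; linarith) (hc.summable 0) (by simp [hR])
    rw [mem_ball_zero_iff] at hw
    rw [norm_mul, norm_mul, norm_pow, Complex.norm_natCast]
    have h1 : ‖w‖ ^ (j - 1) ≤ R ^ j :=
      (pow_le_pow_left₀ (norm_nonneg _) hw.le _).trans (pow_le_pow_right₀ hR1 (Nat.sub_le _ _))
    calc ‖c j‖ * (j * ‖w‖ ^ (j - 1)) ≤ ‖c j‖ * (j * R ^ j) := by gcongr
      _ = _ := by ring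
  convert hd using 1
  have hs : Summable fun j : ℕ => c j * (j * z ^ (j - 1)) := by
    rw [← summable_nat_add_iff 1]
    refine (hc.derivSeq.summable z).congr fun j => ?_
    simp [SingularSchrodinger.derivSeq]
    ring
  rw [hs.tsum_eq_zero_add]
  simp only [Nat.cast_zero, zero_mul, mul_zero, zero_add]
  refine tsum_congr fun j => ?_
  simp [SingularSchrodinger.derivSeq]
  ring

/-- The coefficients of Kummer's function. -/
def kummerCoeff (a b : ℂ) (j : ℕ) : ℂ :=
  (ascPochhammer ℂ j).eval a / ((ascPochhammer ℂ j).eval b * (j.factorial : ℂ))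

theorem add_natCast_ne_zero {b : ℂ} (hb : 0 < b.re) (j : ℕ) : b + j ≠ 0 := by
  intro h
  have := congrArg Complex.re h
  simp at this
  have hj : (0 : ℝ) ≤ j := Nat.cast_nonneg j
  linarith

/-- This recursion is Kummer's equation read coefficientwise. The hypothesis on `b` keeps all the
Pochhammer denominators nonzero. -/
theorem kummerCoeff_succ {a b : ℂ} (hb : 0 < b.re) (j : ℕ) :
    ((j : ℂ) + 1) * (b + j) * kummerCoeff a b (j + 1) = (a + j) * kummerCoeff a b j := by
  have h1 : ∀ i : ℕ, (ascPochhammer ℂ i).eval b ≠ 0 := by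
    intro i
    induction i with
    | zero => simp
    | succ i ih => rw [ascPochhammer_succ_eval]; exact mul_ne_zero ih (add_natCast_ne_zero hb i)
  have h2 : (j.factorial : ℂ) ≠ 0 := by exact_mod_cast j.factorial_ne_zero
  have h3 : (j : ℂ) + 1 ≠ 0 := by exact_mod_cast Nat.succ_ne_zero j
  have h4 := add_natCast_ne_zero hb j
  have h5 := h1 j
  simp only [kummerCoeff, ascPochhammer_succ_eval, Nat.factorial_succ, Nat.cast_mul, Nat.cast_add,
    Nat.cast_one]
  field_simp

theorem isEntireSeq_kummerCoeff {a b : ℂ} (hb : 0 < b.re) : IsEntireSeq (kummerCoeff a b) := by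
  intro R
  refine summable_of_ratio_norm_eventually_le (r := 1 / 2) (by norm_num) ?_
  -- For `j ≥ 1` the recursion bounds the ratio of consecutive terms by `(‖a‖ + 1)|R| / (j + 1)`,
  -- which is at most `1/2` from this `J` on.
  obtain ⟨J, hJ⟩ := exists_nat_ge (2 * ((‖a‖ + 1) * |R|))
  filter_upwards [Filter.eventually_ge_atTop (max J 1)] with j hj
  have hj1 : (1 : ℝ) ≤ j := by exact_mod_cast (le_max_right J 1).trans hj
  have hjJ : (J : ℝ) ≤ j := by exact_mod_cast (le_max_left J 1).trans hj
  have h := congrArg norm (kummerCoeff_succ (a := a) hb j)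
  have h3 : ‖((j : ℂ) + 1)‖ = (j : ℝ) + 1 := by
    have : ((j : ℂ) + 1) = ((j + 1 : ℕ) : ℂ) := by push_cast; rfl
    rw [this, Complex.norm_natCast]
    push_cast; rfl
  rw [norm_mul, norm_mul, norm_mul, h3] at h
  have hbj : (j : ℝ) ≤ ‖b + j‖ := by
    refine le_trans ?_ (Complex.re_le_norm _)
    simp; linarith
  have haj : ‖a + j‖ ≤ (‖a‖ + 1) * j := by
    refine (norm_add_le _ _).trans ?_
    rw [Complex.norm_natCast]
    nlinarith [norm_nonneg a]
  set x := ‖kummerCoeff a b (j + 1)‖ with hx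
  set y := ‖kummerCoeff a b j‖ with hy
  have hx0 : 0 ≤ x := norm_nonneg _
  have hy0 : 0 ≤ y := norm_nonneg _
  have h4 : (j + 1) * x ≤ (‖a‖ + 1) * y := by
    have h5 : (j : ℝ) * ((j + 1) * x) ≤ j * ((‖a‖ + 1) * y) := by
      calc (j : ℝ) * ((j + 1) * x) ≤ ‖b + j‖ * ((j + 1) * x) := by gcongr
        _ = ‖a + j‖ * y := by rw [← h]; ring
        _ ≤ ((‖a‖ + 1) * j) * y := by gcongr
        _ = _ := by ring
    exact le_of_mul_le_mul_left h5 (by linarith)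
  simp only [norm_mul, norm_pow, Real.norm_eq_abs, pow_succ, abs_of_nonneg hx0,
    abs_of_nonneg hy0]
  have hA := norm_nonneg a
  have hR0 := abs_nonneg R
  have h6 : x * |R| ≤ 1 / 2 * y := by
    have h7 : (j + 1) * (x * |R|) ≤ (j + 1) * (1 / 2 * y) := by
      calc (j + 1) * (x * |R|) = ((j + 1) * x) * |R| := by ring
        _ ≤ ((‖a‖ + 1) * y) * |R| := by gcongr
        _ = ((‖a‖ + 1) * |R|) * y := by ring
        _ ≤ ((j + 1) / 2) * y := by gcongr; linarith
        _ = _ := by ring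
    exact le_of_mul_le_mul_left h7 (by linarith)
  have h8 : 0 ≤ |R| ^ j := by positivity
  calc x * (|R| ^ j * |R|) = (x * |R|) * |R| ^ j := by ring
    _ ≤ (1 / 2 * y) * |R| ^ j := by gcongr
    _ = _ := by ring

theorem contDiff_kummer {a b : ℂ} (hb : 0 < b.re) : ContDiff ℂ ∞ (kummer a b) := by
  have h : Differentiable ℂ (kummer a b) := fun z =>
    ((isEntireSeq_kummerCoeff (a := a) hb).hasDerivAt z).differentiableAt
  exact h.contDiff

theorem kummer_zero (a b : ℂ) : kummer a b 0 = 1 := by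
  rw [kummer, tsum_eq_single 0]
  · simp
  · intro j hj
    simp [hj]

/-- Kummer's differential equation. -/
theorem kummer_ode {a b : ℂ} (hb : 0 < b.re) (z : ℂ) :
    z * deriv (deriv (kummer a b)) z + (b - z) * deriv (kummer a b) z - a * kummer a b z = 0 := by
  set c := kummerCoeff a b with hc
  have hE : IsEntireSeq c := isEntireSeq_kummerCoeff hb
  have h0 : kummer a b = fun z => ∑' j, c j * z ^ j := rfl
  have h1 : deriv (kummer a b) = fun z => ∑' j, derivSeq c j * z ^ j := by
    funext w; exact (hE.hasDerivAt w).deriv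
  have h2 : deriv (deriv (kummer a b)) z = ∑' j, derivSeq (derivSeq c) j * z ^ j := by
    rw [h1]; exact (hE.derivSeq.hasDerivAt z).deriv
  rw [h2, h1, h0]
  have s0 := hE.summable z
  have s1 := hE.derivSeq.summable z
  have s2 := hE.derivSeq.derivSeq.summable z
  -- Multiplication by `z` undoes the index shift of differentiation, so every term of the equation
  -- becomes a series in the same `z ^ j` and the coefficients can be compared.
  have hs2 : Summable fun j : ℕ => (j : ℂ) * derivSeq c j * z ^ j := by
    rw [← summable_nat_add_iff 1]
    refine (s2.mul_left z).congr fun j => ?_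
    simp [derivSeq]
    ring
  have t2 : z * ∑' j, derivSeq (derivSeq c) j * z ^ j = ∑' j : ℕ, j * derivSeq c j * z ^ j := by
    rw [hs2.tsum_eq_zero_add, ← tsum_mul_left]
    simp only [Nat.cast_zero, zero_mul, zero_add]
    refine tsum_congr fun j => ?_
    simp [derivSeq]
    ring
  have hs1 : Summable fun j : ℕ => (j : ℂ) * c j * z ^ j := by
    rw [← summable_nat_add_iff 1]
    refine (s1.mul_left z).congr fun j => ?_
    simp [derivSeq]
    ring
  have t1 : z * ∑' j, derivSeq c j * z ^ j = ∑' j : ℕ, j * c j * z ^ j := by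
    rw [hs1.tsum_eq_zero_add, ← tsum_mul_left]
    simp only [Nat.cast_zero, zero_mul, zero_add]
    refine tsum_congr fun j => ?_
    simp [derivSeq]
    ring
  beta_reduce
  rw [sub_mul, t2, t1, ← tsum_mul_left, ← tsum_mul_left, ← (s1.mul_left b).tsum_sub hs1,
    ← hs2.tsum_add ((s1.mul_left b).sub hs1),
    ← (hs2.add ((s1.mul_left b).sub hs1)).tsum_sub (s0.mul_left a)]
  refine (tsum_congr fun j => ?_).trans tsum_zero
  have := kummerCoeff_succ (a := a) hb j
  rw [← hc] at this
  simp only [derivSeq]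
  linear_combination z ^ j * this

end Kummer

/-! ### The functions `Fmlk` are `K`-finite solutions. -/

section Solutions

variable {n : ℕ} {f g : EuclideanSpace ℝ (Fin n) → ℂ}

/-- The function `e^{-imθ/2} f(y)`. -/
def fourierTensor (m : ℤ) (f : EuclideanSpace ℝ (Fin n) → ℂ) : Fn n :=
  fun p => Complex.exp (-(Complex.I * m * p.1) / 2) * f p.2

theorem fourierTensor_injective {m : ℤ} (h : fourierTensor m f = fourierTensor m g) : f = g := by
  funext y
  simpa [fourierTensor] using congrFun h (0, y)

theorem fourierTensor_sub (m : ℤ) :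
    fourierTensor m (f - g) = fourierTensor m f - fourierTensor m g := by
  funext p
  simp [fourierTensor, mul_sub]

theorem fourierTensor_smul (m : ℤ) (c : ℂ) :
    fourierTensor m (c • f) = c • fourierTensor m f := by
  funext p
  simp [fourierTensor]
  ring

theorem contDiff_fourierTensor (m : ℤ) (hf : ContDiff ℝ ∞ f) :
    ContDiff ℝ ∞ (fourierTensor m f) := by
  refine ContDiff.mul ?_ (hf.comp contDiff_snd)
  refine ContDiff.cexp ?_
  have : ContDiff ℝ ∞ (fun p : ℝ × EuclideanSpace ℝ (Fin n) => (p.1 : ℂ)) :=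
    Complex.ofRealCLM.contDiff.comp contDiff_fst
  exact ((contDiff_const.mul this).neg).div_const 2

theorem contDiff_of_fourierTensor {m : ℤ} (h : ContDiff ℝ ∞ (fourierTensor m f)) :
    ContDiff ℝ ∞ f := by
  have h1 : ContDiff ℝ ∞ (fun y => fourierTensor m f ((0 : ℝ), y)) :=
    h.comp (contDiff_const.prodMk contDiff_id)
  simpa [fourierTensor] using h1

theorem OmegaOp_fourierTensor (s : ℂ) (m : ℤ) (hf : ContDiff ℝ ∞ f) :
    OmegaOp n s (fourierTensor m f) = fourierTensor m fun y =>
      ((‖y‖ ^ 2 : ℝ) : ℂ) * ((4 * s ^ 2 * ((‖y‖ ^ 2 : ℝ) : ℂ) - 2 * Complex.I * m * s) * f y +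
        Laplacian.laplacian f y) := by
  funext p
  have h1 : HasDerivAt (fun t : ℝ => fourierTensor m f (t, p.2))
      (Complex.exp (-(Complex.I * m * p.1) / 2) * (-(Complex.I * m) / 2) * f p.2) p.1 := by
    have h0 : HasDerivAt (fun t : ℝ => -(Complex.I * m * t) / 2) (-(Complex.I * m) / 2) p.1 := by
      have h3 := ((Complex.ofRealCLM.hasDerivAt (x := p.1)).const_mul (-(Complex.I * m) / 2))
      refine (h3.congr_deriv (by simp)).congr_of_eventuallyEq (Filter.Eventually.of_forall ?_)
      intro t
      simp
      ring
    exact h0.cexp.mul_const (f p.2)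
  have h2 : Laplacian.laplacian (fun y => fourierTensor m f (p.1, y)) p.2 =
      Complex.exp (-(Complex.I * m * p.1) / 2) * Laplacian.laplacian f p.2 :=
    InnerProductSpace.laplacian_smul (Complex.exp (-(Complex.I * m * p.1) / 2))
      (contDiff_infty.1 hf 2).contDiffAt
  simp only [OmegaOp, h1.deriv, h2]
  simp only [fourierTensor]
  ring

theorem I_zpow_eq_of_dvd {a b : ℤ} (h : (4 : ℤ) ∣ a - b) : Complex.I ^ a = Complex.I ^ b := by
  obtain ⟨c, hc⟩ := h
  have h1 : a = b + 4 * c := by omega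
  have h4 : Complex.I ^ (4 : ℤ) = 1 := by
    rw [show (4 : ℤ) = ((4 : ℕ) : ℤ) from rfl, zpow_natCast, Complex.I_pow_four]
  rw [h1, zpow_add₀ Complex.I_ne_zero, zpow_mul, h4, one_zpow, mul_one]

theorem dvd_of_I_zpow_eq {a b : ℤ} (h : Complex.I ^ a = Complex.I ^ b) : (4 : ℤ) ∣ a - b := by
  have h1 : Complex.I ^ (a - b) = 1 := by
    rw [zpow_sub₀ Complex.I_ne_zero, h, div_self (zpow_ne_zero _ Complex.I_ne_zero)]
  have h2 : Complex.I ^ ((a - b) % 4) = 1 := by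
    rw [← h1]
    exact I_zpow_eq_of_dvd (by omega)
  have h3 : 0 ≤ (a - b) % 4 := Int.emod_nonneg _ (by norm_num)
  have h4 : (a - b) % 4 < 4 := Int.emod_lt_of_pos _ (by norm_num)
  refine Int.dvd_of_emod_eq_zero ?_
  generalize (a - b) % 4 = r at *
  interval_cases r
  · rfl
  · have := congrArg Complex.im h2; simp at this
  · rw [show (2 : ℤ) = ((2 : ℕ) : ℤ) from rfl, zpow_natCast, Complex.I_sq] at h2
    norm_num at h2
  · rw [show (3 : ℤ) = ((3 : ℕ) : ℤ) from rfl, zpow_natCast, Complex.I_pow_three] at h2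
    have := congrArg Complex.im h2; simp at this

theorem exp_mul_pi_div_two (m j : ℤ) :
    Complex.exp (-(Complex.I * m * (j * Real.pi : ℝ)) / 2) = Complex.I ^ (-(m * j)) := by
  have h : Complex.exp (Real.pi / 2 * Complex.I) = Complex.I := Complex.exp_pi_div_two_mul_I
  conv_rhs => rw [← h]
  rw [← Complex.exp_int_mul]
  congr 1
  push_cast
  ring

theorem fourierTensor_add_pi (m j : ℤ) (θ : ℝ) (y : EuclideanSpace ℝ (Fin n)) :
    fourierTensor m f (θ + j * Real.pi, y) = Complex.I ^ (-(m * j)) * fourierTensor m f (θ, y) := by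
  rw [← exp_mul_pi_div_two]
  simp only [fourierTensor]
  rw [← mul_assoc, ← Complex.exp_add]
  congr 2
  push_cast
  ring

theorem zmod_four_iff (m : ℤ) (k : ℕ) (q : ZMod 4) :
    (m : ZMod 4) = 2 * (k : ZMod 4) + q ↔ (4 : ℤ) ∣ m - (2 * k + q.val) := by
  have h1 : (2 * (k : ZMod 4) + q) = ((2 * k + q.val : ℤ) : ZMod 4) := by
    push_cast
    simp
  rw [h1, eq_comm, ZMod.intCast_eq_intCast_iff_dvd_sub]
  rfl

theorem neg_one_pow_eq_I_zpow (k : ℕ) : (-1 : ℂ) ^ k = Complex.I ^ (2 * k : ℤ) := by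
  rw [zpow_mul, zpow_natCast]
  congr 1
  rw [show (2 : ℤ) = ((2 : ℕ) : ℤ) from rfl, zpow_natCast, Complex.I_sq]

/-- The shift `θ + jπ` contributes `i^{-mj}` and the parity of `f` contributes `i^{2kj}`; their
product is `i^{-jq}` because `m ≡ 2k + q` modulo `4`. -/
theorem fourierTensor_mem_compactPicture {q : ZMod 4} {m : ℤ} {k : ℕ} (hf : ContDiff ℝ ∞ f)
    (hpar : ∀ y, f (-y) = (-1) ^ k * f y) (hm : (m : ZMod 4) = 2 * (k : ZMod 4) + q) :
    fourierTensor m f ∈ compactPicture n q := by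
  refine ⟨contDiff_fourierTensor m hf, fun j θ y => ?_⟩
  have h1 : f ((-1 : ℝ) ^ j • y) = Complex.I ^ (2 * k * j : ℤ) * f y := by
    rcases Int.even_or_odd j with hj | hj
    · rw [hj.neg_one_zpow, one_smul]
      obtain ⟨r, rfl⟩ := hj
      rw [I_zpow_eq_of_dvd (b := 0) (by exact ⟨k * r, by ring⟩)]
      simp
    · rw [hj.neg_one_zpow, neg_one_smul, hpar, neg_one_pow_eq_I_zpow]
      obtain ⟨r, rfl⟩ := hj
      rw [I_zpow_eq_of_dvd (a := 2 * k) (b := 2 * k * (2 * r + 1)) (by exact ⟨-(k * r), by ring⟩)]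
  obtain ⟨c, hc⟩ := (zmod_four_iff m k q).1 hm
  rw [fourierTensor_add_pi]
  simp only [fourierTensor, h1]
  rw [I_zpow_eq_of_dvd (a := -(j * (q.val : ℤ))) (b := -(m * j) + 2 * k * j)
    ⟨c * j, by linear_combination j * hc⟩, zpow_add₀ Complex.I_ne_zero]
  ring

theorem partialDeriv_comp_polyFun {φ : ℂ → ℂ} (hφ : Differentiable ℂ φ)
    (Q : MvPolynomial (Fin n) ℂ) (i : Fin n) :
    partialDeriv i (φ ∘ polyFun Q) = (deriv φ ∘ polyFun Q) * polyFun (pderiv i Q) := by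
  funext y
  have h1 := (differentiable_of_contDiff (contDiff_polyFun Q) y).hasFDerivAt
  have h2 := (hφ (polyFun Q y)).hasDerivAt.comp_hasFDerivAt y h1
  rw [partialDeriv, h2.fderiv, ← partialDeriv_polyFun]
  simp [partialDeriv]

theorem contDiff_comp_polyFun {φ : ℂ → ℂ} (hφ : Differentiable ℂ φ) (Q : MvPolynomial (Fin n) ℂ) :
    ContDiff ℝ ∞ (φ ∘ polyFun Q) :=
  (hφ.contDiff.restrict_scalars ℝ).comp (contDiff_polyFun Q)

/-- The radial variable is `w = ‖y‖²`, a polynomial, so an entire `φ` gives a function smooth at the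
origin. The coefficient `4d` of `φ'` is the cross term, evaluated by Euler's identity. -/
theorem laplacian_radial_mul_polyFun {φ : ℂ → ℂ} (hφ : Differentiable ℂ φ) {d : ℕ}
    {H : MvPolynomial (Fin n) ℂ} (hH : H.IsHomogeneous d) (y : EuclideanSpace ℝ (Fin n)) :
    Laplacian.laplacian ((φ ∘ polyFun (normSqPoly n)) * polyFun H) y =
      (4 * ((‖y‖ ^ 2 : ℝ) : ℂ) * deriv (deriv φ) ((‖y‖ ^ 2 : ℝ) : ℂ) +
        (2 * n + 4 * d) * deriv φ ((‖y‖ ^ 2 : ℝ) : ℂ)) * polyFun H y +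
      φ ((‖y‖ ^ 2 : ℝ) : ℂ) * polyFun (lapPoly H) y := by
  have hφ' : Differentiable ℂ (deriv φ) :=
    (contDiff_infty_iff_deriv.1 (hφ.contDiff (n := ∞))).2.differentiable (by simp)
  have c0 := contDiff_comp_polyFun hφ (normSqPoly n)
  have c1 := contDiff_comp_polyFun hφ' (normSqPoly n)
  have cH : ContDiff ℝ ∞ ((φ ∘ polyFun (normSqPoly n)) * polyFun H) := c0.mul (contDiff_polyFun H)
  rw [laplacian_eq_sum_partialDeriv cH, Finset.sum_apply]
  have h1 : ∀ i : Fin n, partialDeriv i (partialDeriv i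
      ((φ ∘ polyFun (normSqPoly n)) * polyFun H)) y =
      (4 * deriv (deriv φ) ((‖y‖ ^ 2 : ℝ) : ℂ) * polyFun H y) * polyFun (X i ^ 2) y +
      2 * deriv φ ((‖y‖ ^ 2 : ℝ) : ℂ) * polyFun H y +
      4 * deriv φ ((‖y‖ ^ 2 : ℝ) : ℂ) * polyFun (X i * pderiv i H) y +
      φ ((‖y‖ ^ 2 : ℝ) : ℂ) * polyFun (pderiv i (pderiv i H)) y := by
    intro i
    have h2 : pderiv i (2 * X i : MvPolynomial (Fin n) ℂ) = C 2 := by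
      rw [show (2 * X i : MvPolynomial (Fin n) ℂ) = C 2 * X i by rw [map_ofNat], pderiv_C_mul]
      simp
    have e1 : ContDiff ℝ ∞ ((deriv φ ∘ polyFun (normSqPoly n)) *
        polyFun (pderiv i (normSqPoly n))) := c1.mul (contDiff_polyFun _)
    have e2 : ContDiff ℝ ∞ ((deriv φ ∘ polyFun (normSqPoly n)) *
        polyFun (pderiv i (normSqPoly n)) * polyFun H) := e1.mul (contDiff_polyFun _)
    have e3 : ContDiff ℝ ∞ ((φ ∘ polyFun (normSqPoly n)) * polyFun (pderiv i H)) :=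
      c0.mul (contDiff_polyFun _)
    rw [partialDeriv_mul c0 (contDiff_polyFun H), partialDeriv_comp_polyFun hφ,
      partialDeriv_polyFun, partialDeriv_add e2 e3,
      partialDeriv_mul e1 (contDiff_polyFun _),
      partialDeriv_mul c1 (contDiff_polyFun _), partialDeriv_mul c0 (contDiff_polyFun _),
      partialDeriv_comp_polyFun hφ', partialDeriv_comp_polyFun hφ, pderiv_normSqPoly,
      partialDeriv_polyFun, partialDeriv_polyFun, partialDeriv_polyFun, h2]
    simp only [Pi.add_apply, Pi.mul_apply, Function.comp_apply, polyFun_normSqPoly]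
    simp only [polyFun, map_mul, map_pow, eval_X, map_ofNat]
    ring
  simp only [h1, Finset.sum_add_distrib, ← Finset.mul_sum]
  have h3 : ∑ i, polyFun (X i ^ 2 : MvPolynomial (Fin n) ℂ) y = ((‖y‖ ^ 2 : ℝ) : ℂ) := by
    rw [← Finset.sum_apply, ← polyFun_sum]
    exact congrFun polyFun_normSqPoly y
  have h4 : ∑ i, polyFun (X i * pderiv i H) y = d * polyFun H y := by
    rw [← Finset.sum_apply, ← polyFun_sum, hH.sum_X_mul_pderiv, ← Nat.cast_smul_eq_nsmul ℂ,
      polyFun_smul]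
    simp
  have h5 : ∑ i, polyFun (pderiv i (pderiv i H)) y = polyFun (lapPoly H) y := by
    rw [← Finset.sum_apply, ← polyFun_sum]
    rfl
  rw [h3, h4, h5]
  simp
  ring

/-- Converse of `exists_harmonic_of_normSq_mul_lap`: each further factor `‖y‖²` raises the
eigenvalue by `2n + 4(2l + k)`. -/
theorem normSq_mul_lap_pow_mul {k : ℕ} {h : MvPolynomial (Fin n) ℂ} (hh : h ∈ harmonicPoly n k)
    (l : ℕ) : normSqPoly n * lapPoly (normSqPoly n ^ l * h) =
      (2 * ((l : ℂ) * (2 * (l : ℂ) + 2 * (k : ℂ) + (n : ℂ) - 2))) • (normSqPoly n ^ l * h) := by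
  induction l with
  | zero =>
    have : lapPoly h = 0 := hh.2
    simp [this]
  | succ l ih =>
    have hd : (normSqPoly n ^ l * h).IsHomogeneous (2 * l + k) :=
      ((isHomogeneous_normSqPoly n).pow l).mul hh.1
    have h1 : normSqPoly n ^ (l + 1) * h = normSqPoly n * (normSqPoly n ^ l * h) := by ring
    rw [h1, lapPoly_normSqPoly_mul hd, ih, ← add_smul, mul_smul_comm]
    congr 1
    push_cast
    ring

/-- The radial factor `e^{-isw} ₁F₁(a, b, 2isw)`. -/
def radialFactor (s a b : ℂ) : ℂ → ℂ :=
  fun w => Complex.exp (-(Complex.I * s * w)) * kummer a b (2 * Complex.I * s * w)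

theorem hasDerivAt_exp_mul_comp {G : ℂ → ℂ} (hG : Differentiable ℂ G) (s w : ℂ) :
    HasDerivAt (fun w => Complex.exp (-(Complex.I * s * w)) * G (2 * Complex.I * s * w))
      (Complex.exp (-(Complex.I * s * w)) * (-(Complex.I * s) * G (2 * Complex.I * s * w) +
        2 * Complex.I * s * deriv G (2 * Complex.I * s * w))) w := by
  have h1 : HasDerivAt (fun w => Complex.exp (-(Complex.I * s * w)))
      (Complex.exp (-(Complex.I * s * w)) * (-(Complex.I * s))) w := by
    have h0 := ((hasDerivAt_id w).const_mul (Complex.I * s)).fun_neg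
    simp only [id, mul_one] at h0
    exact h0.cexp
  have h2 : HasDerivAt (fun w => G (2 * Complex.I * s * w))
      (deriv G (2 * Complex.I * s * w) * (2 * Complex.I * s)) w := by
    refine HasDerivAt.comp w (hG _).hasDerivAt ?_
    simpa using (hasDerivAt_id w).const_mul (2 * Complex.I * s)
  refine (h1.mul h2).congr_deriv ?_
  ring

theorem differentiable_kummer {a b : ℂ} (hb : 0 < b.re) : Differentiable ℂ (kummer a b) :=
  (contDiff_kummer hb).differentiable (by simp)

theorem differentiable_radialFactor {a b : ℂ} (s : ℂ) (hb : 0 < b.re) :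
    Differentiable ℂ (radialFactor s a b) := fun w =>
  (hasDerivAt_exp_mul_comp (differentiable_kummer hb) s w).differentiableAt

/-- Conjugating by `e^{-isw}` cancels the term `s²w`. What remains is `2is` times Kummer's equation
at `z = 2isw`, and its zeroth-order coefficient forces the first parameter to be `b/2 + m/4`. -/
theorem radialFactor_ode {b : ℂ} (s m w : ℂ) (hb : 0 < b.re) :
    w * deriv (deriv (radialFactor s (b / 2 + m / 4) b)) w +
      b * deriv (radialFactor s (b / 2 + m / 4) b) w +
      (s ^ 2 * w - Complex.I * m * s / 2) * radialFactor s (b / 2 + m / 4) b w = 0 := by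
  set M := kummer (b / 2 + m / 4) b with hM
  have d0 : Differentiable ℂ M := differentiable_kummer hb
  have d1 : Differentiable ℂ (deriv M) :=
    (contDiff_infty_iff_deriv.1 (d0.contDiff (n := ∞))).2.differentiable (by simp)
  have h1 : deriv (radialFactor s (b / 2 + m / 4) b) = fun w =>
      -(Complex.I * s) * (Complex.exp (-(Complex.I * s * w)) * M (2 * Complex.I * s * w)) +
      2 * Complex.I * s * (Complex.exp (-(Complex.I * s * w)) *
        deriv M (2 * Complex.I * s * w)) := by
    funext w
    rw [show radialFactor s (b / 2 + m / 4) b = fun w =>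
      Complex.exp (-(Complex.I * s * w)) * M (2 * Complex.I * s * w) from rfl,
      (hasDerivAt_exp_mul_comp d0 s w).deriv]
    ring
  have h2 := ((hasDerivAt_exp_mul_comp d0 s w).const_mul (-(Complex.I * s))).add
    ((hasDerivAt_exp_mul_comp d1 s w).const_mul (2 * Complex.I * s))
  have h3 := h2.deriv
  rw [← Pi.add_def] at h1
  rw [← h1] at h3
  rw [h3, h1]
  simp only [Pi.add_apply]
  have hode := kummer_ode (a := b / 2 + m / 4) hb (2 * Complex.I * s * w)
  rw [← hM] at hode
  simp only [radialFactor, ← hM]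
  generalize Complex.exp (-(Complex.I * s * w)) = e at *
  generalize deriv (deriv M) (2 * Complex.I * s * w) = M2 at *
  generalize deriv M (2 * Complex.I * s * w) = M1 at *
  generalize M (2 * Complex.I * s * w) = M0 at *
  linear_combination (2 * Complex.I * s * e) * hode + e * M0 * s ^ 2 * w * Complex.I_sq

/-- The `y`-part of `Fmlk`. -/
def solution (n : ℕ) (s : ℂ) (m : ℤ) (l k : ℕ) (h : MvPolynomial (Fin n) ℂ) :
    EuclideanSpace ℝ (Fin n) → ℂ :=
  (radialFactor s (((m : ℂ) + 4 * l + 2 * k + n) / 4) (2 * l + k + (n : ℂ) / 2) ∘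
    polyFun (normSqPoly n)) * polyFun (normSqPoly n ^ l * h)

theorem Fmlk_eq (s : ℂ) (m : ℤ) (l k : ℕ) (h : MvPolynomial (Fin n) ℂ) :
    Fmlk n s m l k h = fourierTensor m (solution n s m l k h) := by
  funext p
  have h1 : polyFun (normSqPoly n ^ l * h) p.2 =
      ((‖p.2‖ ^ 2 : ℝ) : ℂ) ^ l * polyFun h p.2 := by
    rw [polyFun_mul, Pi.mul_apply]
    congr 1
    rw [polyFun_apply, map_pow, ← polyFun_apply, polyFun_normSqPoly]
  simp only [Fmlk, fourierTensor, solution, Pi.mul_apply, h1, Function.comp_apply,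
    polyFun_normSqPoly, radialFactor, polyFun_apply]
  push_cast
  ring

section

variable {s : ℂ} {m : ℤ} {l k : ℕ} {h : MvPolynomial (Fin n) ℂ}

theorem param_re_pos (hn : 1 ≤ n) (l k : ℕ) : 0 < (2 * l + k + (n : ℂ) / 2 : ℂ).re := by
  have h1 : (2 * l + k + (n : ℂ) / 2 : ℂ) = ((2 * l + k + (n : ℝ) / 2 : ℝ) : ℂ) := by push_cast; rfl
  rw [h1, Complex.ofReal_re]
  have : (1 : ℝ) ≤ n := by exact_mod_cast hn
  positivity

theorem contDiff_solution (hn : 1 ≤ n) : ContDiff ℝ ∞ (solution n s m l k h) :=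
  (contDiff_comp_polyFun (differentiable_radialFactor s (param_re_pos hn l k)) _).mul
    (contDiff_polyFun _)

theorem isHomogeneous_pow_mul (hh : h ∈ harmonicPoly n k) :
    (normSqPoly n ^ l * h).IsHomogeneous (2 * l + k) :=
  ((isHomogeneous_normSqPoly n).pow l).mul hh.1

/-- With `b = 2l + k + n/2`, the coefficient `2n + 4(2l + k)` in `laplacian_radial_mul_polyFun`
equals `4b`. Four times the radial equation therefore cancels everything except the radial factor
times `‖y‖² Δ(‖y‖^{2l} h)`, which is an eigenvector. -/
theorem solution_pde (hn : 1 ≤ n) (hh : h ∈ harmonicPoly n k) (y : EuclideanSpace ℝ (Fin n)) :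
    ((‖y‖ ^ 2 : ℝ) : ℂ) * ((4 * s ^ 2 * ((‖y‖ ^ 2 : ℝ) : ℂ) - 2 * Complex.I * m * s) *
      solution n s m l k h y + Laplacian.laplacian (solution n s m l k h) y) =
    2 * ((l : ℂ) * (2 * (l : ℂ) + 2 * (k : ℂ) + (n : ℂ) - 2)) * solution n s m l k h y := by
  have hb := param_re_pos hn l k
  have ha : ((m : ℂ) + 4 * l + 2 * k + n) / 4 = (2 * l + k + (n : ℂ) / 2) / 2 + (m : ℂ) / 4 := by
    ring
  have hlap := congrFun (congrArg polyFun (normSq_mul_lap_pow_mul hh l)) y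
  rw [polyFun_mul, polyFun_smul, Pi.mul_apply, polyFun_normSqPoly] at hlap
  simp only [Pi.smul_apply, smul_eq_mul] at hlap
  have hode := radialFactor_ode s m ((‖y‖ ^ 2 : ℝ) : ℂ) hb
  rw [← ha] at hode
  have h1 := laplacian_radial_mul_polyFun (differentiable_radialFactor s (a :=
    ((m : ℂ) + 4 * l + 2 * k + n) / 4) hb) (isHomogeneous_pow_mul (l := l) hh) y
  simp only [solution]
  rw [h1]
  simp only [Pi.mul_apply, Function.comp_apply, polyFun_normSqPoly]
  push_cast at *
  linear_combination (4 * ((‖y‖ : ℂ) ^ 2) * polyFun (normSqPoly n ^ l * h) y) * hode +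
    radialFactor s (((m : ℂ) + 4 * l + 2 * k + n) / 4) (2 * l + k + (n : ℂ) / 2)
      ((‖y‖ : ℂ) ^ 2) * hlap

/-- Composition of a polynomial with a linear map. -/
theorem exists_polyFun_comp (u : EuclideanSpace ℝ (Fin n) →ₗ[ℝ] EuclideanSpace ℝ (Fin n)) {d : ℕ}
    {P : MvPolynomial (Fin n) ℂ} (hP : P.IsHomogeneous d) :
    ∃ Q : MvPolynomial (Fin n) ℂ, Q.IsHomogeneous d ∧ ∀ y, polyFun Q y = polyFun P (u y) := by
  refine ⟨aeval (fun i => ∑ j, C (((u (EuclideanSpace.single j 1)) i : ℝ) : ℂ) * X j) P, ?_, ?_⟩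
  · have := hP.aeval (fun i => ∑ j, C (((u (EuclideanSpace.single j 1)) i : ℝ) : ℂ) * X j)
      (n := 1) fun i => IsHomogeneous.sum _ _ _ fun j _ => isHomogeneous_C_mul_X _ _
    rwa [one_mul] at this
  · intro y
    have h1 : ∀ i, ((u y i : ℝ) : ℂ) =
        ∑ j, (((u (EuclideanSpace.single j 1)) i : ℝ) : ℂ) * ((y j : ℝ) : ℂ) := by
      intro i
      conv_lhs => rw [← (EuclideanSpace.basisFun (Fin n) ℝ).sum_repr y]
      simp [mul_comm]
    simp only [polyFun, h1]
    clear hP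
    induction P using MvPolynomial.induction_on with
    | C a => simp
    | add p q hp hq => rw [map_add, map_add, map_add, hp, hq]
    | mul_X p i hp => rw [map_mul, map_mul, map_mul, hp]; simp

/-- The radial factor `E` is rotation invariant and translation in `θ` is a scalar, so the whole
orbit lies in the image of the finite-dimensional space of homogeneous polynomials of degree `2l +
k`. -/
theorem isKFinite_solution (hh : h ∈ harmonicPoly n k) :
    IsKFinite n (fourierTensor m (solution n s m l k h)) := by
  set E := (radialFactor s (((m : ℂ) + 4 * l + 2 * k + n) / 4) (2 * l + k + (n : ℂ) / 2) ∘
    polyFun (normSqPoly n)) with hE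
  let Λ : homogeneousSubmodule (Fin n) ℂ (2 * l + k) →ₗ[ℂ] Fn n :=
    { toFun := fun Q => fourierTensor m (E * polyFun Q.1)
      map_add' := fun P Q => by
        funext p
        simp only [Submodule.coe_add, polyFun_add, fourierTensor, Pi.mul_apply, Pi.add_apply]
        ring
      map_smul' := fun c P => by
        funext p
        simp only [Submodule.coe_smul, polyFun_smul, fourierTensor, Pi.mul_apply, Pi.smul_apply,
          smul_eq_mul, RingHom.id_apply]
        ring }
  have hfin : FiniteDimensional ℂ (homogeneousSubmodule (Fin n) ℂ (2 * l + k)) :=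
    Module.Finite.iff_fg.2 (homogeneousSubmodule_fg _ _ _)
  have hle : kSpan n (fourierTensor m (solution n s m l k h)) ≤ LinearMap.range Λ := by
    refine Submodule.span_le.2 ?_
    rintro _ ⟨⟨α, u⟩, rfl⟩
    obtain ⟨Q, hQ, hQu⟩ := exists_polyFun_comp u.symm.toLinearEquiv.toLinearMap
      (isHomogeneous_pow_mul (l := l) hh)
    refine ⟨⟨Complex.exp (Complex.I * m * α / 2) • Q, isHomogeneous_smul _ hQ⟩, ?_⟩
    funext p
    simp only [Λ, LinearMap.coe_mk, AddHom.coe_mk, polyFun_smul, fourierTensor, Pi.mul_apply,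
      Pi.smul_apply, smul_eq_mul, kAct, LinearMap.funLeft_apply, solution, hQu, hE,
      Function.comp_apply, polyFun_normSqPoly, LinearIsometryEquiv.norm_map]
    have h1 : Complex.exp (-(Complex.I * m * ((p.1 - α : ℝ) : ℂ)) / 2) =
        Complex.exp (-(Complex.I * m * p.1) / 2) * Complex.exp (Complex.I * m * α / 2) := by
      rw [← Complex.exp_add]
      congr 1
      push_cast
      ring
    rw [h1]
    simp
    ring
  exact Submodule.finiteDimensional_of_le hle

theorem solution_neg (hh : h ∈ harmonicPoly n k) (y : EuclideanSpace ℝ (Fin n)) :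
    solution n s m l k h (-y) = (-1) ^ k * solution n s m l k h y := by
  have h1 := polyFun_real_smul (isHomogeneous_pow_mul (l := l) hh) (-1) y
  rw [neg_one_smul] at h1
  simp only [solution, Pi.mul_apply, Function.comp_apply, polyFun_normSqPoly, norm_neg, h1]
  push_cast
  rw [pow_add, pow_mul]
  simp
  ring

theorem Fmlk_mem_kerOmegaK {q : ZMod 4} {lam : ℂ} (hn : 1 ≤ n) (hpair : IsAdmissiblePair n lam l k)
    (hh : h ∈ harmonicPoly n k) (hm : (m : ZMod 4) = 2 * (k : ZMod 4) + q) :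
    Fmlk n s m l k h ∈ kerOmegaK n q s lam := by
  rw [Fmlk_eq]
  refine ⟨⟨fourierTensor_mem_compactPicture (contDiff_solution hn) (solution_neg hh) hm, ?_⟩,
    isKFinite_solution hh⟩
  rw [OmegaOp_fourierTensor s m (contDiff_solution hn), ← fourierTensor_smul]
  congr 1
  funext y
  rw [solution_pde hn hh, ← hpair.1]
  rfl

/-- The solution agrees with its leading polynomial to higher order at the origin. -/
theorem vanishesToOrder_solution_sub (hn : 1 ≤ n) (hh : h ∈ harmonicPoly n k) :
    VanishesToOrder (2 * l + k + 1)
      (solution n s m l k h - polyFun (normSqPoly n ^ l * h)) := by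
  have hd := differentiable_radialFactor s (a := ((m : ℂ) + 4 * l + 2 * k + n) / 4)
    (param_re_pos hn l k)
  have c0 := contDiff_comp_polyFun hd (normSqPoly n)
  -- The radial factor is `1` at the origin; subtracting that value gains one order over the
  -- polynomial factor.
  have h1 : solution n s m l k h - polyFun (normSqPoly n ^ l * h) =
      polyFun (normSqPoly n ^ l * h) *
      ((radialFactor s (((m : ℂ) + 4 * l + 2 * k + n) / 4) (2 * l + k + (n : ℂ) / 2) ∘
        polyFun (normSqPoly n)) - fun _ => 1) := by
    funext y
    simp only [solution, Pi.mul_apply, Pi.sub_apply]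
    ring
  rw [h1]
  refine (vanishesToOrder_polyFun (isHomogeneous_pow_mul hh)).mul (contDiff_polyFun _)
    (c0.sub contDiff_const) ⟨?_, fun _ => trivial⟩
  simp [polyFun_normSqPoly, radialFactor, kummer_zero]

end

end Solutions

/-! ### Uniqueness for solutions flat at the origin. -/

section FlatUniqueness

variable {n : ℕ}

/-- While a nonzero `f` remains, imposing vanishing at a point where `f ≠ 0` lowers the dimension.
-/
theorem exists_finset_separating {X : Type*} (d : ℕ) :
    ∀ W : Submodule ℂ (X → ℂ), FiniteDimensional ℂ W → Module.finrank ℂ W = d →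
      ∃ S : Finset X, ∀ f ∈ W, (∀ x ∈ S, f x = 0) → f = 0 := by
  classical
  induction d using Nat.strong_induction_on with
  | _ d ih =>
    intro W hW hd
    by_cases h0 : ∀ f ∈ W, f = 0
    · exact ⟨∅, fun f hf _ => h0 f hf⟩
    · push Not at h0
      obtain ⟨f, hf, hf0⟩ := h0
      obtain ⟨x, hx⟩ := Function.ne_iff.1 hf0
      set W' := W ⊓ LinearMap.ker (LinearMap.proj x : (X → ℂ) →ₗ[ℂ] ℂ) with hW'
      have hlt : W' < W := by
        refine lt_of_le_of_ne inf_le_left fun h => hx ?_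
        have h1 : f ∈ W' := h ▸ hf
        exact h1.2
      obtain ⟨S, hS⟩ := ih (Module.finrank ℂ W') (hd ▸ Submodule.finrank_lt_finrank_of_lt hlt) W'
        (Submodule.finiteDimensional_of_le inf_le_left) rfl
      refine ⟨insert x S, fun g hg hgS => hS g ⟨hg, ?_⟩ fun y hy => ?_⟩
      · exact hgS x (Finset.mem_insert_self _ _)
      · exact hgS y (Finset.mem_insert_of_mem hy)

/-- A finite dimensional space of functions is determined by evaluation at finitely many points. -/
theorem exists_evaluation_points {X : Type*} (W : Submodule ℂ (X → ℂ)) [hW : FiniteDimensional ℂ W] :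
    ∃ (S : Finset X) (b : S → X → ℂ), (∀ i, b i ∈ W) ∧
      ∀ f ∈ W, ∀ y, f y = ∑ i : S, f i * b i y := by
  classical
  obtain ⟨S, hS⟩ := exists_finset_separating _ W hW rfl
  let ev : W →ₗ[ℂ] (S → ℂ) := (LinearMap.funLeft ℂ ℂ (fun i : S => (i : X))) ∘ₗ W.subtype
  have hker : LinearMap.ker ev = ⊥ := by
    rw [LinearMap.ker_eq_bot']
    rintro ⟨f, hf⟩ h
    have := hS f hf fun x hx => congrFun h ⟨x, hx⟩
    exact Subtype.ext this
  -- The functions `b i` are the images of the unit vectors under a left inverse of evaluation. They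
  -- need not be independent; only the interpolation formula is used.
  obtain ⟨g, hg⟩ := ev.exists_leftInverse_of_injective hker
  refine ⟨S, fun i => (g (Pi.single i 1) : X → ℂ), fun i => (g _).2, fun f hf y => ?_⟩
  have h1 : g (ev ⟨f, hf⟩) = ⟨f, hf⟩ := LinearMap.congr_fun hg ⟨f, hf⟩
  have h2 : ev ⟨f, hf⟩ = ∑ i : S, f i • (Pi.single i 1 : S → ℂ) := by
    funext j
    simp [ev, LinearMap.funLeft_apply, Finset.sum_apply, Pi.single_apply]
  rw [h2, map_sum] at h1
  have h3 := congrArg (fun w : W => (w : X → ℂ) y) h1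
  simp only [map_smul, Submodule.coe_sum, Submodule.coe_smul, Finset.sum_apply, Pi.smul_apply,
    smul_eq_mul] at h3
  exact h3.symm

/-- A flat nonnegative solution of `r e' ≤ L e` vanishes. -/
theorem eq_zero_of_flat_of_deriv_le {e e' : ℝ → ℝ} {R L : ℝ}
    (hpos : ∀ r, 0 ≤ e r) (hd : ∀ r, 0 < r → HasDerivAt e (e' r) r)
    (hle : ∀ r, 0 < r → r ≤ R → r * e' r ≤ L * e r)
    (hflat : ∀ N : ℕ, ∃ C, ∀ r, 0 < r → r ≤ R → e r ≤ C * r ^ N) {r : ℝ} (hr : 0 < r)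
    (hrR : r ≤ R) : e r = 0 := by
  obtain ⟨N, hN⟩ := exists_nat_ge L
  -- For `N ≥ L` the derivative of `e r^{-N}` has the sign of `r e' - N e ≤ 0`, so the quotient is
  -- nonincreasing. Flatness to order `N + 1` makes it tend to `0` at the origin, hence it is never
  -- positive.
  set h : ℝ → ℝ := fun r => e r * (r ^ N)⁻¹ with hh
  have hderiv : ∀ x, 0 < x → HasDerivAt h
      (e' x * (x ^ N)⁻¹ + e x * (-(N * x ^ (N - 1)) / (x ^ N) ^ 2)) x := by
    intro x hx
    exact (hd x hx).mul ((hasDerivAt_pow N x).fun_inv (pow_ne_zero N hx.ne'))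
  have hanti : AntitoneOn h (Set.Ioc 0 R) := by
    refine antitoneOn_of_deriv_nonpos (convex_Ioc 0 R)
      (fun x hx => (hderiv x hx.1).continuousAt.continuousWithinAt)
      (fun x hx => (hderiv x (interior_subset hx).1).differentiableAt.differentiableWithinAt) ?_
    intro x hx
    obtain ⟨hx0, hxR⟩ := interior_subset hx
    rw [(hderiv x hx0).deriv]
    have hxN : 0 < x ^ N := pow_pos hx0 N
    have h1 : e' x * (x ^ N)⁻¹ + e x * (-(N * x ^ (N - 1)) / (x ^ N) ^ 2) =
        (x * e' x - N * e x) * (x ^ (N + 1))⁻¹ := by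
      rcases N with _ | N
      · simp
        field_simp
      · simp only [Nat.add_sub_cancel]
        field_simp
        ring
    rw [h1]
    refine mul_nonpos_of_nonpos_of_nonneg ?_ (by positivity)
    have h2 := hle x hx0 hxR
    have h3 := hpos x
    nlinarith
  obtain ⟨C, hC⟩ := hflat (N + 1)
  have hbound : ∀ x, 0 < x → x ≤ r → h r ≤ C * x := by
    intro x hx hxr
    refine (hanti ⟨hx, hxr.trans hrR⟩ ⟨hr, hrR⟩ hxr).trans ?_
    have hxN : 0 < x ^ N := pow_pos hx N
    calc h x ≤ (C * x ^ (N + 1)) * (x ^ N)⁻¹ := by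
          simp only [hh]
          gcongr
          exact hC x hx (hxr.trans hrR)
      _ = C * x := by
          field_simp
          ring
  have h0 : h r ≤ 0 := by
    have hlim : Filter.Tendsto (fun x : ℝ => C * x) (nhdsWithin 0 (Set.Ioi 0)) (nhds (C * 0)) :=
      ((continuous_const.mul continuous_id).tendsto 0).mono_left nhdsWithin_le_nhds
    rw [mul_zero] at hlim
    refine ge_of_tendsto hlim ?_
    filter_upwards [Ioc_mem_nhdsGT hr] with x hx using hbound x hx.1 hx.2
  have hrN : 0 < r ^ N := pow_pos hr N
  have h1 : e r = h r * r ^ N := by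
    simp only [hh]
    field_simp
  have h2 := hpos r
  nlinarith

/-- A flat solution of a linear system `r p' = A(r) p` with bounded coefficients vanishes. -/
theorem eq_zero_of_flat_of_norm_deriv_le {κ : Type*} [Fintype κ] {p p' : κ → ℝ → ℂ} {R K : ℝ}
    (hd : ∀ a r, HasDerivAt (p a) (p' a r) r)
    (hle : ∀ a r, 0 < r → r ≤ R → ‖(r : ℂ) * p' a r‖ ≤ K * ∑ b, ‖p b r‖)
    (hflat : ∀ a, ∀ N : ℕ, ∃ C, ∀ r, 0 < r → r ≤ R → ‖p a r‖ ≤ C * r ^ N) {r : ℝ} (hr : 0 < r)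
    (hrR : r ≤ R) (a : κ) : p a r = 0 := by
  -- The energy of the system satisfies `r e' ≤ 2|K| (card κ) e` by Cauchy–Schwarz, which reduces to
  -- the scalar case.
  set e : ℝ → ℝ := fun r => ∑ a, ‖p a r‖ ^ 2 with he
  have hd' : ∀ x, HasDerivAt e (∑ a, 2 * inner ℝ (p a x) (p' a x)) x := fun x =>
    HasDerivAt.fun_sum fun a _ => (hd a x).norm_sq
  have hK : ∀ x, 0 < x → x ≤ R →
      x * (∑ a, 2 * inner ℝ (p a x) (p' a x)) ≤ (2 * |K| * Fintype.card κ) * e x := by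
    intro x hx hxR
    have h1 : ∀ a, x * (2 * inner ℝ (p a x) (p' a x)) ≤ 2 * |K| * (∑ b, ‖p b x‖) * ‖p a x‖ := by
      intro a
      have h2 := real_inner_le_norm (p a x) (p' a x)
      have h3 := hle a x hx hxR
      rw [norm_mul, Complex.norm_real, Real.norm_of_nonneg hx.le] at h3
      have hS : 0 ≤ ∑ b, ‖p b x‖ := Finset.sum_nonneg fun _ _ => norm_nonneg _
      have h4 : K * ∑ b, ‖p b x‖ ≤ |K| * ∑ b, ‖p b x‖ := by gcongr; exact le_abs_self K
      calc x * (2 * inner ℝ (p a x) (p' a x)) ≤ x * (2 * (‖p a x‖ * ‖p' a x‖)) := by gcongr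
        _ = 2 * (x * ‖p' a x‖) * ‖p a x‖ := by ring
        _ ≤ 2 * (|K| * ∑ b, ‖p b x‖) * ‖p a x‖ :=
            mul_le_mul_of_nonneg_right (by linarith) (norm_nonneg _)
        _ = _ := by ring
    rw [Finset.mul_sum]
    refine (Finset.sum_le_sum fun a _ => h1 a).trans ?_
    rw [← Finset.mul_sum]
    have h5 := sq_sum_le_card_mul_sum_sq (s := (Finset.univ : Finset κ)) (f := fun a => ‖p a x‖)
    have h6 : 0 ≤ 2 * |K| := by positivity
    calc 2 * |K| * (∑ b, ‖p b x‖) * ∑ a, ‖p a x‖ = 2 * |K| * (∑ b, ‖p b x‖) ^ 2 := by ring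
      _ ≤ 2 * |K| * ((Fintype.card κ : ℝ) * e x) := by
          gcongr
          simpa using h5
      _ = _ := by ring
  have hfl : ∀ N : ℕ, ∃ C, ∀ r, 0 < r → r ≤ R → e r ≤ C * r ^ N := by
    intro N
    choose C hC using fun a => hflat a N
    choose D hD using fun a => hflat a 0
    refine ⟨∑ a, D a * C a, fun x hx hxR => ?_⟩
    rw [Finset.sum_mul]
    refine Finset.sum_le_sum fun a _ => ?_
    have h1 := hC a x hx hxR
    have h2 := hD a x hx hxR
    rw [pow_zero, mul_one] at h2
    have h3 := norm_nonneg (p a x)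
    calc ‖p a x‖ ^ 2 = ‖p a x‖ * ‖p a x‖ := sq _
      _ ≤ D a * (C a * x ^ N) := by gcongr; exact h3.trans h2
      _ = _ := by ring
  have h0 := eq_zero_of_flat_of_deriv_le (fun r => Finset.sum_nonneg fun _ _ => by positivity)
    (fun x _ => hd' x) hK hfl hr hrR
  have h1 := (Finset.sum_eq_zero_iff_of_nonneg (fun a _ => by positivity)).1 h0 a
    (Finset.mem_univ a)
  simpa using h1

/-- The vector whose orthogonal reflection sends `eᵢ` to `cos t eᵢ + sin t eⱼ`. -/
def reflectionVector (i j : Fin n) (t : ℝ) : EuclideanSpace ℝ (Fin n) :=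
  -Real.sin (t / 2) • EuclideanSpace.single i 1 + Real.cos (t / 2) • EuclideanSpace.single j 1

/-- The reflection sending `eᵢ` to `cos t eᵢ + sin t eⱼ`. -/
def planeReflection (i j : Fin n) (t : ℝ) :
    EuclideanSpace ℝ (Fin n) ≃ₗᵢ[ℝ] EuclideanSpace ℝ (Fin n) :=
  (Submodule.span ℝ {reflectionVector i j t})ᗮ.reflection

theorem inner_single_single_of_ne {i j : Fin n} (hij : j ≠ i) :
    inner ℝ (EuclideanSpace.single j (1 : ℝ)) (EuclideanSpace.single i (1 : ℝ)) = 0 := by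
  rw [EuclideanSpace.inner_single_left]
  simp [hij]

theorem norm_reflectionVector {i j : Fin n} (hij : j ≠ i) (t : ℝ) :
    ‖reflectionVector i j t‖ = 1 := by
  have h : ‖reflectionVector i j t‖ ^ 2 = 1 := by
    rw [reflectionVector, norm_add_sq_real, inner_smul_left, inner_smul_right,
      inner_single_single_of_ne hij.symm, norm_smul, norm_smul]
    simp
  nlinarith [norm_nonneg (reflectionVector i j t)]

theorem planeReflection_apply {i j : Fin n} (hij : j ≠ i) (t : ℝ)
    (x : EuclideanSpace ℝ (Fin n)) :
    planeReflection i j t x =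
      x - (2 * inner ℝ (reflectionVector i j t) x) • reflectionVector i j t := by
  rw [planeReflection, Submodule.reflection_orthogonal_apply, Submodule.reflection_singleton_apply,
    norm_reflectionVector hij]
  simp [two_smul, add_smul, two_mul]

/-- The unit normal is perpendicular to the direction of angle `t/2`, so the mirror bisects `eᵢ` and
its image. Only the image of the ray through `eᵢ` matters, so a reflection serves as well as a
rotation. -/
theorem planeReflection_single {i j : Fin n} (hij : j ≠ i) (t r : ℝ) :
    planeReflection i j t (r • EuclideanSpace.single i 1) =
      (r * Real.cos t) • EuclideanSpace.single i 1 +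
        (r * Real.sin t) • EuclideanSpace.single j 1 := by
  rw [planeReflection_apply hij]
  have hc : Real.cos t = 1 - 2 * Real.sin (t / 2) ^ 2 := by
    have := Real.cos_two_mul (t / 2)
    rw [mul_div_cancel₀ t two_ne_zero] at this
    nlinarith [Real.sin_sq_add_cos_sq (t / 2)]
  have hs : Real.sin t = 2 * Real.sin (t / 2) * Real.cos (t / 2) := by
    have := Real.sin_two_mul (t / 2)
    rwa [mul_div_cancel₀ t two_ne_zero] at this
  rw [hc, hs]
  have hin : inner ℝ (reflectionVector i j t) (r • EuclideanSpace.single i (1 : ℝ)) =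
      -(r * Real.sin (t / 2)) := by
    simp [reflectionVector, inner_add_left, inner_smul_left, inner_smul_right,
      inner_single_single_of_ne hij]
  rw [hin, reflectionVector]
  module

theorem contDiff_planeReflection {i j : Fin n} (hij : j ≠ i) (x : EuclideanSpace ℝ (Fin n)) :
    ContDiff ℝ ∞ fun t => planeReflection i j t x := by
  simp only [planeReflection_apply hij]
  have hv : ContDiff ℝ ∞ (fun t : ℝ => reflectionVector i j t) := by
    unfold reflectionVector
    have h1 : ContDiff ℝ ∞ (fun t : ℝ => t / 2) := contDiff_id.div_const 2
    exact ((Real.contDiff_sin.comp h1).neg.smul contDiff_const).add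
      ((Real.contDiff_cos.comp h1).smul contDiff_const)
  exact contDiff_const.sub ((contDiff_const.mul (hv.inner ℝ contDiff_const)).smul hv)

variable {f : EuclideanSpace ℝ (Fin n) → ℂ}

/-- The second derivative of `f` along a circle in the plane of `eᵢ` and `eⱼ`. -/
theorem deriv_deriv_comp_circle (hf : ContDiff ℝ ∞ f) (i j : Fin n) (r : ℝ) :
    deriv (deriv fun t : ℝ => f ((r * Real.cos t) • EuclideanSpace.single i 1 +
      (r * Real.sin t) • EuclideanSpace.single j 1)) 0 =
    (r : ℂ) ^ 2 * partialDeriv j (partialDeriv j f) (r • EuclideanSpace.single i 1) -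
      r * partialDeriv i f (r • EuclideanSpace.single i 1) := by
  set ei : EuclideanSpace ℝ (Fin n) := EuclideanSpace.single i 1
  set ej : EuclideanSpace ℝ (Fin n) := EuclideanSpace.single j 1
  have hγ : ∀ t : ℝ, HasDerivAt (fun t : ℝ => (r * Real.cos t) • ei + (r * Real.sin t) • ej)
      ((r * -Real.sin t) • ei + (r * Real.cos t) • ej) t := fun t =>
    (((Real.hasDerivAt_cos t).const_mul r).smul_const ei).add
      (((Real.hasDerivAt_sin t).const_mul r).smul_const ej)
  have hγ' : HasDerivAt (fun t : ℝ => (r * -Real.sin t) • ei + (r * Real.cos t) • ej)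
      ((r * -Real.cos 0) • ei + (r * -Real.sin 0) • ej) 0 :=
    (((Real.hasDerivAt_sin 0).neg.const_mul r).smul_const ei).add
      (((Real.hasDerivAt_cos 0).const_mul r).smul_const ej)
  have h1 : (deriv fun t : ℝ => f ((r * Real.cos t) • ei + (r * Real.sin t) • ej)) =
      fun t => fderiv ℝ f ((r * Real.cos t) • ei + (r * Real.sin t) • ej)
        ((r * -Real.sin t) • ei + (r * Real.cos t) • ej) := by
    funext t
    exact ((differentiable_of_contDiff hf _).hasFDerivAt.comp_hasDerivAt t (hγ t)).deriv
  rw [h1]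
  -- The circle has velocity `r eⱼ` and acceleration `-r eᵢ` at `t = 0`; the acceleration produces
  -- the first-order term.
  have h2 := ((differentiable_fderiv hf _).hasFDerivAt.comp_hasDerivAt 0 (hγ 0)).clm_apply hγ'
  simp only [Function.comp_apply] at h2
  rw [h2.deriv, partialDeriv_partialDeriv hf, partialDeriv]
  simp [ei, ej]
  ring

theorem deriv_deriv_sum_mul {ι : Type*} (s : Finset ι) {g : ι → ℝ → ℂ} (c : ι → ℂ)
    (hg : ∀ i, ContDiff ℝ ∞ (g i)) (t : ℝ) :
    deriv (deriv fun t => ∑ i ∈ s, g i t * c i) t = ∑ i ∈ s, deriv (deriv (g i)) t * c i := by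
  have hd : ∀ i, Differentiable ℝ (g i) := fun i => (hg i).differentiable (by simp)
  have hd' : ∀ i, Differentiable ℝ (deriv (g i)) := fun i =>
    (contDiff_infty_iff_deriv.1 (hg i)).2.differentiable (by simp)
  have h1 : (deriv fun t => ∑ i ∈ s, g i t * c i) = fun t => ∑ i ∈ s, deriv (g i) t * c i := by
    funext t
    exact (HasDerivAt.fun_sum fun i _ => ((hd i t).hasDerivAt.mul_const (c i))).deriv
  rw [h1]
  exact (HasDerivAt.fun_sum fun i _ => ((hd' i t).hasDerivAt.mul_const (c i))).deriv

/-- Uniqueness for a finite dimensional rotation invariant space of functions that are flat at the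
origin and satisfy `‖y‖² Δ f = V(‖y‖) f`. -/
theorem eq_zero_of_flat (hn : 0 < n) (W : Submodule ℂ (EuclideanSpace ℝ (Fin n) → ℂ))
    [FiniteDimensional ℂ W]
    (hinv : ∀ f ∈ W, ∀ u : EuclideanSpace ℝ (Fin n) ≃ₗᵢ[ℝ] EuclideanSpace ℝ (Fin n), f ∘ u ∈ W)
    (hsm : ∀ f ∈ W, ContDiff ℝ ∞ f)
    (hflat : ∀ f ∈ W, ∀ (N : ℕ) (R : ℝ), ∃ C, ∀ y, ‖y‖ ≤ R →
      ‖f y‖ ≤ C * ‖y‖ ^ N ∧ ‖fderiv ℝ f y‖ ≤ C * ‖y‖ ^ N)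
    {V : ℝ → ℂ} (hV : Continuous V)
    (hpde : ∀ f ∈ W, ∀ y, ((‖y‖ ^ 2 : ℝ) : ℂ) * Laplacian.laplacian f y = V ‖y‖ * f y) :
    ∀ f ∈ W, f = 0 := by
  classical
  obtain ⟨S, b, hbW, hb⟩ := exists_evaluation_points W
  set i : Fin n := ⟨0, hn⟩
  set e : EuclideanSpace ℝ (Fin n) := EuclideanSpace.single i 1 with he
  have hne : ‖e‖ = 1 := by simp [he]
  have hnr : ∀ r : ℝ, 0 < r → ‖r • e‖ = r := by
    intro r hr
    rw [norm_smul, hne, mul_one, Real.norm_of_nonneg hr.le]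
  -- Moving `r e` along a circle replaces `b a` by another element of `W`, whose value at `r e` is a
  -- combination of the `b k (r e)` with coefficients depending on `t` but not on `r`. Two
  -- derivatives at `t = 0` express the transverse second derivatives with constants `c`.
  have hrot : ∀ (j : Fin n) (a : S), ∃ c : S → ℂ, j ≠ i → ∀ r : ℝ,
      (r : ℂ) ^ 2 * partialDeriv j (partialDeriv j (b a)) (r • e) =
        r * partialDeriv i (b a) (r • e) + ∑ k, c k * b k (r • e) := by
    intro j a
    refine ⟨fun k => deriv (deriv fun t => b a (planeReflection i j t k)) 0, fun hij r => ?_⟩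
    have h1 : (fun t : ℝ => b a ((r * Real.cos t) • EuclideanSpace.single i 1 +
        (r * Real.sin t) • EuclideanSpace.single j 1)) =
        fun t => ∑ k : S, b a (planeReflection i j t k) * b k (r • e) := by
      funext t
      rw [← planeReflection_single hij]
      exact hb _ (hinv _ (hbW a) (planeReflection i j t)) (r • e)
    have h2 := deriv_deriv_comp_circle (hsm _ (hbW a)) i j r
    rw [h1, deriv_deriv_sum_mul Finset.univ (g := fun (k : S) t => b a (planeReflection i j t k))
      (fun k => b k (r • e))
      (fun k => (hsm _ (hbW a)).comp (contDiff_planeReflection hij _))] at h2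
    linear_combination -h2
  choose c hc using hrot
  have hzero : ∀ R r : ℝ, 0 < r → r ≤ R → ∀ a, b a (r • e) = 0 := by
    intro R r hr hrR a
    obtain ⟨B, hB⟩ := (isCompact_Icc (a := (0 : ℝ)) (b := R)).exists_bound_of_continuousOn
      hV.continuousOn
    set T : ℝ := ∑ j, ∑ a, ∑ k, ‖c j a k‖ with hT
    have hT0 : 0 ≤ T := by positivity
    have hcT : ∀ j a k, ‖c j a k‖ ≤ T := by
      intro j a k
      calc ‖c j a k‖ ≤ ∑ k, ‖c j a k‖ :=
            Finset.single_le_sum (f := fun k => ‖c j a k‖) (fun _ _ => norm_nonneg _)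
              (Finset.mem_univ k)
        _ ≤ ∑ a, ∑ k, ‖c j a k‖ :=
            Finset.single_le_sum (f := fun a => ∑ k, ‖c j a k‖) (fun _ _ => by positivity)
              (Finset.mem_univ a)
        _ ≤ T := Finset.single_le_sum (f := fun j => ∑ a, ∑ k, ‖c j a k‖)
              (fun _ _ => by positivity) (Finset.mem_univ j)
    -- Weighting the radial derivative by `r` makes the second-order equation a system `r p' = A(r)
    -- p` with `A` bounded on `(0, R]`.
    let p : S ⊕ S → ℝ → ℂ := Sum.elim (fun a r => b a (r • e))
      (fun a r => (r : ℂ) * partialDeriv i (b a) (r • e))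
    let p' : S ⊕ S → ℝ → ℂ := Sum.elim (fun a r => partialDeriv i (b a) (r • e))
      (fun a r => partialDeriv i (b a) (r • e) +
        r * partialDeriv i (partialDeriv i (b a)) (r • e))
    have hline : ∀ (g : EuclideanSpace ℝ (Fin n) → ℂ), ContDiff ℝ ∞ g → ∀ r : ℝ,
        HasDerivAt (fun r : ℝ => g (r • e)) (partialDeriv i g (r • e)) r := by
      intro g hg r
      have h1 : HasDerivAt (fun r : ℝ => r • e) e r := by
        simpa using (hasDerivAt_id r).smul_const e
      exact (differentiable_of_contDiff hg _).hasFDerivAt.comp_hasDerivAt r h1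
    have hd : ∀ a r, HasDerivAt (p a) (p' a r) r := by
      rintro (a | a) r
      · exact hline _ (hsm _ (hbW a)) r
      · have h1 : HasDerivAt (fun r : ℝ => (r : ℂ)) 1 r := Complex.ofRealCLM.hasDerivAt
        have h2 := h1.mul (hline _ (contDiff_partialDeriv (hsm _ (hbW a)) i) r)
        rw [one_mul] at h2
        exact h2
    have hfl : ∀ a, ∀ N : ℕ, ∃ C, ∀ r, 0 < r → r ≤ R → ‖p a r‖ ≤ C * r ^ N := by
      rintro (a | a) N
      · obtain ⟨C, hC⟩ := hflat _ (hbW a) N R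
        refine ⟨C, fun r hr hrR => ?_⟩
        have := (hC (r • e) (by rwa [hnr r hr])).1
        rwa [hnr r hr] at this
      · obtain ⟨C, hC⟩ := hflat _ (hbW a) N R
        refine ⟨R * C, fun r hr hrR => ?_⟩
        have h1 := (hC (r • e) (by rwa [hnr r hr])).2
        rw [hnr r hr] at h1
        have h2 : ‖partialDeriv i (b a) (r • e)‖ ≤ ‖fderiv ℝ (b a) (r • e)‖ := by
          have := (fderiv ℝ (b a) (r • e)).le_opNorm e
          rwa [hne, mul_one] at this
        simp only [p, Sum.elim_inr, norm_mul, Complex.norm_real, Real.norm_of_nonneg hr.le]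
        rw [mul_assoc]
        exact mul_le_mul hrR (h2.trans h1) (norm_nonneg _) (hr.le.trans hrR)
    -- In the constant, `1` accounts for the component `r ∂ᵢ b`, `|B|` for `V`, and `n + nT` for the
    -- at most `n` transverse directions, each contributing `r ∂ᵢ b` and a combination of the `b k`
    -- with coefficients bounded by `T`.
    have hle : ∀ a r, 0 < r → r ≤ R →
        ‖(r : ℂ) * p' a r‖ ≤ (1 + |B| + n + n * T) * ∑ a, ‖p a r‖ := by
      intro a r hr hrR
      set Q := ∑ a, ‖p a r‖ with hQ
      have hsingle : ∀ a, ‖p a r‖ ≤ Q := fun a =>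
        Finset.single_le_sum (f := fun a => ‖p a r‖) (fun _ _ => norm_nonneg _) (Finset.mem_univ a)
      have hQ0 : 0 ≤ Q := by positivity
      rcases a with a | a
      · have h1 : (r : ℂ) * p' (Sum.inl a) r = p (Sum.inr a) r := rfl
        rw [h1]
        refine (hsingle _).trans ?_
        have : 0 ≤ (|B| + n + n * T) * Q := by positivity
        linarith
      · have hΔ := hpde _ (hbW a) (r • e)
        rw [hnr r hr, laplacian_eq_sum_partialDeriv (hsm _ (hbW a)), Finset.sum_apply,
          ← Finset.add_sum_erase _ _ (Finset.mem_univ i), mul_add, Finset.mul_sum,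
          Finset.sum_congr rfl fun j hj => by
            rw [show ((r ^ 2 : ℝ) : ℂ) = (r : ℂ) ^ 2 by push_cast; rfl,
              hc j a (Finset.ne_of_mem_erase hj) r]] at hΔ
        have h1 : (r : ℂ) * p' (Sum.inr a) r = p (Sum.inr a) r + V r * p (Sum.inl a) r -
            ∑ j ∈ Finset.univ.erase i,
              (p (Sum.inr a) r + ∑ k, c j a k * p (Sum.inl k) r) := by
          simp only [p, p', Sum.elim_inl, Sum.elim_inr]
          rw [← hΔ]
          push_cast
          ring
        have h2 : ∀ j, ‖p (Sum.inr a) r + ∑ k, c j a k * p (Sum.inl k) r‖ ≤ Q + T * Q := by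
          intro j
          refine (norm_add_le _ _).trans (add_le_add (hsingle _) ?_)
          refine (norm_sum_le _ _).trans ?_
          calc ∑ k, ‖c j a k * p (Sum.inl k) r‖ ≤ ∑ k, T * ‖p (Sum.inl k) r‖ := by
                refine Finset.sum_le_sum fun k _ => ?_
                rw [norm_mul]
                gcongr
                exact hcT j a k
            _ = T * ∑ k, ‖p (Sum.inl k) r‖ := by rw [Finset.mul_sum]
            _ ≤ T * Q := by
                gcongr
                rw [hQ, Fintype.sum_sum_type]
                have : 0 ≤ ∑ k, ‖p (Sum.inr k) r‖ := by positivity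
                linarith
        have h3 : ‖∑ j ∈ Finset.univ.erase i,
            (p (Sum.inr a) r + ∑ k, c j a k * p (Sum.inl k) r)‖ ≤ n * (Q + T * Q) := by
          refine (norm_sum_le _ _).trans ((Finset.sum_le_sum fun j _ => h2 j).trans ?_)
          rw [Finset.sum_const, nsmul_eq_mul]
          gcongr
          calc (Finset.univ.erase i).card ≤ (Finset.univ : Finset (Fin n)).card :=
                Finset.card_le_card (Finset.erase_subset _ _)
            _ = n := by simp
        have h4 : ‖V r * p (Sum.inl a) r‖ ≤ |B| * Q := by
          rw [norm_mul]
          have := hB r ⟨hr.le, hrR⟩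
          exact mul_le_mul (this.trans (le_abs_self B)) (hsingle _) (norm_nonneg _) (abs_nonneg _)
        rw [h1]
        refine (norm_sub_le _ _).trans ?_
        refine (add_le_add (norm_add_le _ _) h3).trans ?_
        have := hsingle (Sum.inr a)
        linarith
    exact eq_zero_of_flat_of_norm_deriv_le hd hle hfl hr hrR (Sum.inl a)
  have hray : ∀ f ∈ W, ∀ r : ℝ, 0 < r → f (r • e) = 0 := by
    intro f hf r hr
    rw [hb f hf]
    exact Finset.sum_eq_zero fun k _ => by rw [hzero r r hr le_rfl, mul_zero]
  intro f hf
  funext y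
  rcases eq_or_ne y 0 with rfl | hy
  · obtain ⟨C, hC⟩ := hflat f hf 1 0
    have := (hC 0 (by simp)).1
    simpa using this
  -- The reflection in the hyperplane orthogonal to `‖y‖ e - y` carries the point `‖y‖ e` of the ray
  -- to `y`.
  · have hy' : 0 < ‖y‖ := norm_pos_iff.2 hy
    have h1 : ‖‖y‖ • e‖ = ‖y‖ := hnr _ hy'
    have h2 := Submodule.reflection_sub h1
    have h3 := hray _ (hinv f hf (Submodule.span ℝ {‖y‖ • e - y})ᗮ.reflection) ‖y‖ hy'
    rw [Function.comp_apply, h2] at h3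
    exact h3

end FlatUniqueness

/-! ### Fourier decomposition of `K`-finite functions in `θ`. -/

section FourierDecomposition

variable {n : ℕ} {f : EuclideanSpace ℝ (Fin n) → ℂ} {F : Fn n} {q : ZMod 4} {s lam : ℂ}

theorem laplacian_comp_isometry (hf : ContDiff ℝ 2 f)
    (u : EuclideanSpace ℝ (Fin n) ≃ₗᵢ[ℝ] EuclideanSpace ℝ (Fin n))
    (y : EuclideanSpace ℝ (Fin n)) :
    Laplacian.laplacian (fun z => f (u z)) y = Laplacian.laplacian f (u y) := by
  rw [InnerProductSpace.laplacian_eq_iteratedFDeriv_orthonormalBasis _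
    (EuclideanSpace.basisFun (Fin n) ℝ),
    InnerProductSpace.laplacian_eq_iteratedFDeriv_orthonormalBasis f
    ((EuclideanSpace.basisFun (Fin n) ℝ).map u)]
  refine Finset.sum_congr rfl fun i _ => ?_
  have h := (u.toContinuousLinearEquiv : EuclideanSpace ℝ (Fin n) →L[ℝ]
    EuclideanSpace ℝ (Fin n)).iteratedFDeriv_comp_right hf y (i := 2) le_rfl
  have h2 : (f ∘ (u.toContinuousLinearEquiv : EuclideanSpace ℝ (Fin n) →L[ℝ]
    EuclideanSpace ℝ (Fin n))) = fun z => f (u z) := rfl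
  rw [h2] at h
  rw [h, ContinuousMultilinearMap.compContinuousLinearMap_apply]
  congr 1
  funext j
  fin_cases j <;> simp

theorem kAct_apply (α : ℝ) (u : EuclideanSpace ℝ (Fin n) ≃ₗᵢ[ℝ] EuclideanSpace ℝ (Fin n))
    (F : Fn n) (p : ℝ × EuclideanSpace ℝ (Fin n)) :
    kAct n α u F p = F (p.1 - α, u.symm p.2) := rfl

theorem kAct_mem_compactPicture (hF : F ∈ compactPicture n q) (α : ℝ)
    (u : EuclideanSpace ℝ (Fin n) ≃ₗᵢ[ℝ] EuclideanSpace ℝ (Fin n)) :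
    kAct n α u F ∈ compactPicture n q := by
  refine ⟨hF.1.comp ((contDiff_fst.sub contDiff_const).prodMk
    (u.symm.contDiff.comp contDiff_snd)), fun j θ y => ?_⟩
  simp only [kAct_apply]
  rw [map_smul, show θ + j * Real.pi - α = (θ - α) + j * Real.pi by ring]
  exact hF.2 j (θ - α) (u.symm y)

theorem OmegaOp_kAct (hF : ContDiff ℝ ∞ F) (α : ℝ)
    (u : EuclideanSpace ℝ (Fin n) ≃ₗᵢ[ℝ] EuclideanSpace ℝ (Fin n)) :
    OmegaOp n s (kAct n α u F) = kAct n α u (OmegaOp n s F) := by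
  funext p
  have h1 : deriv (fun t : ℝ => F (t - α, u.symm p.2)) p.1 =
      deriv (fun t : ℝ => F (t, u.symm p.2)) (p.1 - α) :=
    deriv_comp_sub_const (fun t : ℝ => F (t, u.symm p.2)) α p.1
  have h2 := laplacian_comp_isometry (contDiff_slice_snd hF (p.1 - α)) u.symm p.2
  simp only [OmegaOp, kAct_apply, h1, h2, LinearIsometryEquiv.norm_map]

theorem kSpan_kAct_le (α : ℝ)
    (u : EuclideanSpace ℝ (Fin n) ≃ₗᵢ[ℝ] EuclideanSpace ℝ (Fin n)) :
    kSpan n (kAct n α u F) ≤ kSpan n F := by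
  refine Submodule.span_le.2 ?_
  rintro _ ⟨⟨β, v⟩, rfl⟩
  refine Submodule.subset_span ⟨(β + α, u.trans v), ?_⟩
  funext p
  simp only [kAct_apply]
  congr 2
  ring

theorem kAct_mem_kerOmegaK (hF : F ∈ kerOmegaK n q s lam) (α : ℝ)
    (u : EuclideanSpace ℝ (Fin n) ≃ₗᵢ[ℝ] EuclideanSpace ℝ (Fin n)) :
    kAct n α u F ∈ kerOmegaK n q s lam := by
  obtain ⟨⟨h1, h2⟩, h3⟩ := hF
  refine ⟨⟨kAct_mem_compactPicture h1 α u, ?_⟩, ?_⟩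
  · rw [OmegaOp_kAct h1.1, h2, map_smul]
  · unfold IsKFinite at *
    exact Submodule.finiteDimensional_of_le (kSpan_kAct_le α u)

theorem kSpan_le_kerOmegaK (hF : F ∈ kerOmegaK n q s lam) : kSpan n F ≤ kerOmegaK n q s lam := by
  refine Submodule.span_le.2 ?_
  rintro _ ⟨g, rfl⟩
  exact kAct_mem_kerOmegaK hF g.1 g.2

theorem periodic_of_mem_compactPicture (hF : F ∈ compactPicture n q)
    (y : EuclideanSpace ℝ (Fin n)) : Function.Periodic (fun θ => F (θ, y)) (4 * Real.pi) := by
  intro θ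
  have h := hF.2 4 θ y
  have h1 : ((-1 : ℝ) ^ (4 : ℤ)) = 1 := by norm_num
  rw [h1, one_smul, I_zpow_eq_of_dvd (b := 0) ⟨-(q.val : ℤ), by ring⟩] at h
  simpa using h

/-- The coefficient of `e^{-imθ/2}` in the Fourier expansion of `F` in `θ`. -/
def fourierComponent (F : Fn n) (m : ℤ) : EuclideanSpace ℝ (Fin n) → ℂ := fun y =>
  (1 / (4 * Real.pi) : ℝ) • ∫ t in (0 : ℝ)..4 * Real.pi,
    Complex.exp (Complex.I * m * t / 2) * F (t, y)

theorem exp_add_four_pi (m : ℤ) (t : ℝ) :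
    Complex.exp (Complex.I * m * ((t + 4 * Real.pi : ℝ) : ℂ) / 2) =
      Complex.exp (Complex.I * m * t / 2) := by
  have h : Complex.I * m * ((t + 4 * Real.pi : ℝ) : ℂ) / 2 =
      Complex.I * m * t / 2 + m * (2 * Real.pi * Complex.I) := by
    push_cast
    ring
  rw [h, Complex.exp_add, Complex.exp_int_mul_two_pi_mul_I, mul_one]

/-- Periodicity absorbs the change of variable `t = θ + α`, which displays the component as an
average of translates of `F`. -/
theorem fourierComponent_shift (hF : F ∈ compactPicture n q) (m : ℤ) (θ : ℝ)
    (y : EuclideanSpace ℝ (Fin n)) :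
    fourierTensor m (fourierComponent F m) (θ, y) =
      (1 / (4 * Real.pi) : ℝ) • ∫ α in (0 : ℝ)..4 * Real.pi,
        Complex.exp (Complex.I * m * α / 2) * F (θ + α, y) := by
  set G : ℝ → ℂ := fun t => Complex.exp (Complex.I * m * t / 2) * F (t, y) with hG
  have hper : Function.Periodic G (4 * Real.pi) := by
    intro t
    have h1 := periodic_of_mem_compactPicture hF y t
    simp only [hG]
    rw [exp_add_four_pi]
    simp only at h1
    rw [h1]
  have h1 : ∀ α : ℝ, Complex.exp (Complex.I * m * α / 2) * F (θ + α, y) =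
      Complex.exp (-(Complex.I * m * θ) / 2) * G (θ + α) := by
    intro α
    simp only [hG]
    rw [← mul_assoc, ← Complex.exp_add]
    congr 2
    push_cast
    ring
  simp only [h1]
  rw [intervalIntegral.integral_const_mul, intervalIntegral.integral_comp_add_left,
    add_zero, hper.intervalIntegral_add_eq θ 0, zero_add]
  simp only [fourierTensor, fourierComponent, Complex.real_smul, hG]
  ring

/-- The component is an integral of translates. Interpolation at finitely many points separates `α`
from `(θ, y)`, so the integral becomes a finite combination of elements of the `K`-span and no
closure argument is needed. -/
theorem fourierTensor_component_mem (hF : F ∈ compactPicture n q) (hfin : IsKFinite n F) (m : ℤ) :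
    fourierTensor m (fourierComponent F m) ∈ kSpan n F := by
  unfold IsKFinite at hfin
  obtain ⟨S, b, hbW, hb⟩ := exists_evaluation_points (kSpan n F)
  have hshift : ∀ (α θ : ℝ) (y : EuclideanSpace ℝ (Fin n)),
      F (θ + α, y) = ∑ i : S, F (i.1.1 + α, i.1.2) * b i (θ, y) := by
    intro α θ y
    have h := hb (kAct n (-α) (LinearIsometryEquiv.refl ℝ _) F)
      (Submodule.subset_span ⟨(-α, LinearIsometryEquiv.refl ℝ _), rfl⟩) (θ, y)
    simp only [kAct_apply, sub_neg_eq_add] at h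
    exact h
  have heq : fourierTensor m (fourierComponent F m) =
      ∑ i : S, ((1 / (4 * Real.pi) : ℝ) • ∫ α in (0 : ℝ)..4 * Real.pi,
        Complex.exp (Complex.I * m * α / 2) * F (i.1.1 + α, i.1.2)) • b i := by
    funext ⟨θ, y⟩
    rw [fourierComponent_shift hF]
    simp only [hshift _ θ y, Finset.mul_sum, Finset.sum_apply, Pi.smul_apply]
    rw [intervalIntegral.integral_finsetSum, Finset.smul_sum]
    · refine Finset.sum_congr rfl fun i _ => ?_
      simp only [← mul_assoc]
      rw [intervalIntegral.integral_mul_const]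
      simp only [Complex.real_smul, smul_eq_mul]
      ring
    · intro i _
      refine Continuous.intervalIntegrable ?_ _ _
      have h1 : Continuous fun α : ℝ => F (i.1.1 + α, i.1.2) :=
        hF.1.continuous.comp (by fun_prop)
      have h2 : Continuous fun α : ℝ => Complex.exp (Complex.I * m * α / 2) := by fun_prop
      exact h2.mul (h1.mul continuous_const)
  rw [heq]
  exact Submodule.sum_mem _ fun i _ => Submodule.smul_mem _ _ (hbW i)

/-- A coincidence between distinct integers would make `π` rational. Hence the single translation by
angle `1` separates all Fourier modes. -/
theorem exp_half_int_injective : Function.Injective fun m : ℤ => Complex.exp (Complex.I * m / 2) := by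
  intro a b h
  obtain ⟨k, hk⟩ := Complex.exp_eq_exp_iff_exists_int.1 h
  have h1 : (a : ℂ) - b = 4 * k * Real.pi := by
    have h2 : Complex.I * ((a : ℂ) - b - 4 * k * Real.pi) = 0 := by linear_combination 2 * hk
    have h3 := (mul_eq_zero.1 h2).resolve_left Complex.I_ne_zero
    linear_combination h3
  have h4 : (a : ℝ) - b = 4 * k * Real.pi := by exact_mod_cast h1
  by_cases hk0 : k = 0
  · rw [hk0] at h4
    have : (a : ℝ) = b := by simpa [sub_eq_zero] using h4
    exact_mod_cast this
  · exfalso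
    refine irrational_pi ⟨((a - b : ℤ) : ℚ) / ((4 * k : ℤ) : ℚ), ?_⟩
    have : (k : ℝ) ≠ 0 := by exact_mod_cast hk0
    push_cast
    field_simp
    linarith

/-- Nonzero components are eigenvectors of translation by `1` with distinct eigenvalues `e^{im/2}`,
hence linearly independent in the finite-dimensional `K`-span. -/
theorem finite_fourierComponent (hF : F ∈ compactPicture n q) (hfin : IsKFinite n F) :
    {m : ℤ | fourierComponent F m ≠ 0}.Finite := by
  have hK := hfin
  unfold IsKFinite at hK
  have hli := Module.End.eigenvectors_linearIndependent'
    (kAct n (1 : ℝ) (LinearIsometryEquiv.refl ℝ _) : Module.End ℂ (Fn n))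
    (fun m : {m : ℤ | fourierComponent F m ≠ 0} => Complex.exp (Complex.I * (m : ℤ) / 2))
    (exp_half_int_injective.comp Subtype.coe_injective)
    (fun m => fourierTensor m (fourierComponent F m)) (by
      rintro ⟨m, hm⟩
      constructor
      · rw [Module.End.mem_eigenspace_iff]
        funext p
        simp only [kAct_apply, fourierTensor, Pi.smul_apply, smul_eq_mul]
        rw [← mul_assoc, ← Complex.exp_add]
        congr 2
        push_cast
        ring
      · intro h0
        refine hm (fourierTensor_injective (m := m) (h0.trans ?_))
        funext p
        simp [fourierTensor])
  let v : {m : ℤ | fourierComponent F m ≠ 0} → kSpan n F := fun m =>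
    ⟨fourierTensor m (fourierComponent F m), fourierTensor_component_mem hF hfin m⟩
  have hv : LinearIndependent ℂ v := LinearIndependent.of_comp (kSpan n F).subtype hli
  exact hv.finite_of_isNoetherian

/-- A `K`-finite function is a finite sum of its Fourier components in `θ`. -/
theorem eq_sum_fourierTensor (hF : F ∈ compactPicture n q) (hfin : IsKFinite n F) :
    F = ∑ m ∈ (finite_fourierComponent hF hfin).toFinset,
      fourierTensor m (fourierComponent F m) := by
  have hfinite := finite_fourierComponent hF hfin
  have : Fact (0 < 4 * Real.pi) := ⟨by positivity⟩
  funext ⟨θ, y⟩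
  have hper := periodic_of_mem_compactPicture hF y
  have hcont : Continuous fun t : ℝ => F (t, y) := hF.1.continuous.comp (by fun_prop)
  let g : C(AddCircle (4 * Real.pi), ℂ) := ⟨hper.lift, continuous_coinduced_dom.mpr hcont⟩
  have hfour : ∀ (k : ℤ) (t : ℝ), fourier k (t : AddCircle (4 * Real.pi)) =
      Complex.exp (Complex.I * k * t / 2) := by
    intro k t
    rw [fourier_coe_apply]
    congr 1
    have : (Real.pi : ℂ) ≠ 0 := by exact_mod_cast Real.pi_ne_zero
    push_cast
    field_simp
    ring
  -- The sign appears because components are indexed by `e^{-imθ/2}`. Only finitely many are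
  -- nonzero, so the Fourier series converges pointwise to `F`.
  have hcoeff : ∀ k : ℤ, fourierCoeff g k = fourierComponent F (-k) y := by
    intro k
    rw [fourierCoeff_eq_intervalIntegral _ _ 0, zero_add]
    simp only [fourierComponent]
    congr 2
    funext t
    rw [hfour]
    rfl
  have hzero : ∀ k ∉ hfinite.toFinset, fourierComponent F k y = 0 := by
    intro k hk
    rw [Set.Finite.mem_toFinset, Set.mem_ofPred_eq, not_not] at hk
    rw [hk]
    rfl
  have hsum : Summable (fourierCoeff g) := by
    rw [← (Equiv.neg ℤ).summable_iff]
    refine summable_of_ne_finset_zero (s := hfinite.toFinset) fun k hk => ?_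
    simp [hcoeff, hzero k hk]
  have h1 := has_pointwise_sum_fourier_series_of_summable hsum (θ : AddCircle (4 * Real.pi))
  rw [← (Equiv.neg ℤ).hasSum_iff] at h1
  have h2 := hasSum_sum_of_ne_finset_zero (L := SummationFilter.unconditional ℤ) (s := hfinite.toFinset)
    (f := (fun i => fourierCoeff g i • fourier i (θ : AddCircle (4 * Real.pi))) ∘ (Equiv.neg ℤ))
    fun k hk => by simp [hcoeff, hzero k hk]
  have h3 := h1.unique h2
  have h4 : g (θ : AddCircle (4 * Real.pi)) = F (θ, y) := rfl
  rw [h4] at h3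
  rw [h3, Finset.sum_apply]
  refine Finset.sum_congr rfl fun m _ => ?_
  simp only [Function.comp_apply, Equiv.neg_apply, hcoeff, neg_neg, hfour, fourierTensor,
    smul_eq_mul]
  rw [mul_comm]
  congr 2
  push_cast
  ring

end FourierDecomposition

/-! ### Leading terms of kernel elements and the span description. -/

section Kernel

variable {n : ℕ} {f : EuclideanSpace ℝ (Fin n) → ℂ} {q : ZMod 4} {s lam : ℂ} {m : ℤ}

theorem contDiff_of_mem (h : fourierTensor m f ∈ kerOmegaK n q s lam) : ContDiff ℝ ∞ f :=
  contDiff_of_fourierTensor h.1.1.1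

theorem pde_of_mem (h : fourierTensor m f ∈ kerOmegaK n q s lam) (y : EuclideanSpace ℝ (Fin n)) :
    ((‖y‖ ^ 2 : ℝ) : ℂ) * ((4 * s ^ 2 * ((‖y‖ ^ 2 : ℝ) : ℂ) - 2 * Complex.I * m * s) * f y +
        Laplacian.laplacian f y) = 2 * lam * f y := by
  have h1 := h.1.2
  rw [OmegaOp_fourierTensor s m (contDiff_of_mem h), ← fourierTensor_smul] at h1
  exact congrFun (fourierTensor_injective h1) y

/-- The equivariance for `j = 1` at `θ = 0`. Compared with the parity of the leading term, it
determines `m` modulo `4`. -/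
theorem parity_of_mem (h : fourierTensor m f ∈ kerOmegaK n q s lam)
    (y : EuclideanSpace ℝ (Fin n)) : f (-y) = Complex.I ^ (m - q.val : ℤ) * f y := by
  have h1 := h.1.1.2 1 0 y
  rw [fourierTensor_add_pi] at h1
  simp only [zpow_one, neg_one_smul, mul_one, one_mul, fourierTensor] at h1
  simp only [Complex.ofReal_zero, mul_zero, neg_zero, zero_div, Complex.exp_zero, one_mul] at h1
  have h2 : Complex.I ^ m * Complex.I ^ (-m) = 1 := by
    rw [← zpow_add₀ Complex.I_ne_zero, add_neg_cancel, zpow_zero]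
  rw [sub_eq_add_neg, zpow_add₀ Complex.I_ne_zero, mul_assoc, ← h1, ← mul_assoc, h2, one_mul]

theorem VanishesToOrder.bound_fderiv (hf : ContDiff ℝ ∞ f) {N : ℕ}
    (h : VanishesToOrder (N + 1) f) (R : ℝ) :
    ∃ C, ∀ y, ‖y‖ ≤ R → ‖fderiv ℝ f y‖ ≤ C * ‖y‖ ^ N := by
  choose C _ hC using fun i => (h.2 i).bound (contDiff_partialDeriv hf i) R
  refine ⟨∑ i, C i, fun y hy => (norm_fderiv_le_sum_partialDeriv y).trans ?_⟩
  rw [Finset.sum_mul]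
  exact Finset.sum_le_sum fun i _ => hC i y hy

/-- Smooth functions on `ℝⁿ` that are flat at the origin and satisfy `‖y‖² Δ g = V(‖y‖) g`. -/
def flatSolutions (n : ℕ) (V : ℝ → ℂ) : Submodule ℂ (EuclideanSpace ℝ (Fin n) → ℂ) where
  carrier := {g | ContDiff ℝ ∞ g ∧
    (∀ (N : ℕ) (R : ℝ), ∃ C, ∀ y, ‖y‖ ≤ R → ‖g y‖ ≤ C * ‖y‖ ^ N ∧ ‖fderiv ℝ g y‖ ≤ C * ‖y‖ ^ N) ∧
    ∀ y, ((‖y‖ ^ 2 : ℝ) : ℂ) * Laplacian.laplacian g y = V ‖y‖ * g y}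
  zero_mem' := by
    refine ⟨contDiff_const, fun N R => ⟨0, fun y _ => ?_⟩, fun y => ?_⟩
    · have : fderiv ℝ (0 : EuclideanSpace ℝ (Fin n) → ℂ) y = 0 := fderiv_const_apply 0
      simp [this]
    · have : Laplacian.laplacian (0 : EuclideanSpace ℝ (Fin n) → ℂ) = 0 :=
        InnerProductSpace.laplacian_const
      simp [this]
  add_mem' := by
    rintro g h ⟨hg, hg1, hg2⟩ ⟨hh, hh1, hh2⟩
    refine ⟨hg.add hh, fun N R => ?_, fun y => ?_⟩
    · obtain ⟨C, hC⟩ := hg1 N R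
      obtain ⟨D, hD⟩ := hh1 N R
      refine ⟨C + D, fun y hy => ⟨?_, ?_⟩⟩
      · rw [add_mul]
        exact (norm_add_le _ _).trans (add_le_add (hC y hy).1 (hD y hy).1)
      · rw [add_mul, fderiv_add (differentiable_of_contDiff hg y) (differentiable_of_contDiff hh y)]
        exact (norm_add_le _ _).trans (add_le_add (hC y hy).2 (hD y hy).2)
    · rw [ContDiffAt.laplacian_add (contDiff_infty.1 hg 2).contDiffAt
        (contDiff_infty.1 hh 2).contDiffAt, mul_add, hg2, hh2, Pi.add_apply, mul_add]
  smul_mem' := by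
    rintro c g ⟨hg, hg1, hg2⟩
    refine ⟨contDiff_const.smul hg, fun N R => ?_, fun y => ?_⟩
    · obtain ⟨C, hC⟩ := hg1 N R
      refine ⟨‖c‖ * C, fun y hy => ⟨?_, ?_⟩⟩
      · rw [Pi.smul_apply, norm_smul, mul_assoc]
        gcongr
        exact (hC y hy).1
      · rw [fderiv_const_smul (differentiable_of_contDiff hg y), norm_smul, mul_assoc]
        gcongr
        exact (hC y hy).2
    · rw [InnerProductSpace.laplacian_smul c (contDiff_infty.1 hg 2).contDiffAt, Pi.smul_apply,
        smul_eq_mul, smul_eq_mul, mul_left_comm, hg2]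
      ring

theorem comp_isometry_mem_flatSolutions {V : ℝ → ℂ} (hf : f ∈ flatSolutions n V)
    (u : EuclideanSpace ℝ (Fin n) ≃ₗᵢ[ℝ] EuclideanSpace ℝ (Fin n)) :
    f ∘ u ∈ flatSolutions n V := by
  obtain ⟨h1, h2, h3⟩ := hf
  refine ⟨h1.comp u.contDiff, fun N R => ?_, fun y => ?_⟩
  · obtain ⟨C, hC⟩ := h2 N R
    refine ⟨C, fun y hy => ?_⟩
    have h4 := hC (u y) (by rwa [u.norm_map])
    rw [u.norm_map] at h4
    refine ⟨h4.1, ?_⟩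
    have h5 : fderiv ℝ (f ∘ u) y =
        (fderiv ℝ f (u y)).comp (u.toContinuousLinearEquiv : EuclideanSpace ℝ (Fin n) →L[ℝ] _) :=
      ((differentiable_of_contDiff h1 (u y)).hasFDerivAt.comp y
        u.toContinuousLinearEquiv.hasFDerivAt).fderiv
    rw [h5]
    refine le_trans (ContinuousLinearMap.opNorm_le_bound _ (norm_nonneg _) fun v => ?_) h4.2
    have h6 := (fderiv ℝ f (u y)).le_opNorm (u v)
    rwa [u.norm_map] at h6
  · have h4 := h3 (u y)
    rw [u.norm_map] at h4
    have h5 := laplacian_comp_isometry (contDiff_infty.1 h1 2) u y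
    have h6 : (fun z => f (u z)) = f ∘ u := rfl
    rw [h6] at h5
    rw [h5, h4, Function.comp_apply]

/-- A flat `K`-finite solution vanishes. -/
theorem eq_zero_of_mem_of_flat (hn : 1 ≤ n) (h : fourierTensor m f ∈ kerOmegaK n q s lam)
    (hflat : ∀ N, VanishesToOrder N f) : f = 0 := by
  set V : ℝ → ℂ := fun r => 2 * lam - (r : ℂ) ^ 2 *
    (4 * s ^ 2 * (r : ℂ) ^ 2 - 2 * Complex.I * m * s) with hV
  have hVc : Continuous V := by fun_prop
  have hf := contDiff_of_mem h
  have hfV : f ∈ flatSolutions n V := by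
    refine ⟨hf, fun N R => ?_, fun y => ?_⟩
    · obtain ⟨C, hC0, hC⟩ := (hflat N).bound hf R
      obtain ⟨D, hD⟩ := (hflat (N + 1)).bound_fderiv hf R
      refine ⟨max C D, fun y hy => ⟨(hC y hy).trans ?_, (hD y hy).trans ?_⟩⟩
      · gcongr
        exact le_max_left _ _
      · gcongr
        exact le_max_right _ _
    · have := pde_of_mem h y
      simp only [hV]
      push_cast at this ⊢
      linear_combination this
  set W := Submodule.span ℂ (Set.range
    fun u : EuclideanSpace ℝ (Fin n) ≃ₗᵢ[ℝ] EuclideanSpace ℝ (Fin n) => f ∘ u) with hW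
  have hWle : W ≤ flatSolutions n V := by
    refine Submodule.span_le.2 ?_
    rintro _ ⟨u, rfl⟩
    exact comp_isometry_mem_flatSolutions hfV u
  have hfin : FiniteDimensional ℂ W := by
    have hK : FiniteDimensional ℂ (kSpan n (fourierTensor m f)) := h.2
    let ρ : Fn n →ₗ[ℂ] (EuclideanSpace ℝ (Fin n) → ℂ) := LinearMap.funLeft ℂ ℂ fun y => ((0 : ℝ), y)
    -- Restriction to `θ = 0` sends the rotates of `e^{-imθ/2} f` to the rotates of `f`, so finite
    -- dimension is inherited.
    have hle : W ≤ (kSpan n (fourierTensor m f)).map ρ := by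
      refine Submodule.span_le.2 ?_
      rintro _ ⟨u, rfl⟩
      refine ⟨kAct n 0 u.symm (fourierTensor m f), Submodule.subset_span ⟨(0, u.symm), rfl⟩, ?_⟩
      funext y
      simp [ρ, LinearMap.funLeft_apply, kAct_apply, fourierTensor]
    exact Submodule.finiteDimensional_of_le hle
  have hinv : ∀ g ∈ W, ∀ u : EuclideanSpace ℝ (Fin n) ≃ₗᵢ[ℝ] EuclideanSpace ℝ (Fin n),
      g ∘ u ∈ W := by
    intro g hg u
    have hle : W ≤ W.comap (LinearMap.funLeft ℂ ℂ u) := by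
      refine Submodule.span_le.2 ?_
      rintro _ ⟨v, rfl⟩
      exact Submodule.subset_span ⟨u.trans v, rfl⟩
    exact hle hg
  exact eq_zero_of_flat hn W hinv (fun g hg => (hWle hg).1) (fun g hg => (hWle hg).2.1) hVc
    (fun g hg => (hWle hg).2.2) f (Submodule.subset_span ⟨LinearIsometryEquiv.refl ℝ _, rfl⟩)

/-- For `k ≥ 2`, Euler's identity applied to `h'` and then to `h` turns `h'' = 0` into `h' = 0` and
`h = 0`. -/
theorem le_one_of_mem_harmonicPoly_one {k : ℕ} {h : MvPolynomial (Fin 1) ℂ}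
    (hh : h ∈ harmonicPoly 1 k) (h0 : h ≠ 0) : k ≤ 1 := by
  by_contra! hk
  obtain ⟨h1, h2⟩ := hh
  simp only [Fin.sum_univ_one] at h2
  have e1 := h1.sum_X_mul_pderiv
  have e2 := (h1.pderiv (i := 0)).sum_X_mul_pderiv
  simp only [Fin.sum_univ_one] at e1 e2
  rw [h2, mul_zero, eq_comm, smul_eq_zero] at e2
  rw [e2.resolve_left (by omega), mul_zero, eq_comm, smul_eq_zero] at e1
  exact e1.elim (by omega) h0

theorem VanishesToOrder.comp_neg (hf : ContDiff ℝ ∞ f) {N : ℕ} (h : VanishesToOrder N f) :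
    VanishesToOrder N fun y => f (-y) := by
  induction N generalizing f with
  | zero => trivial
  | succ N ih =>
    refine ⟨by simpa using h.1, fun i => ?_⟩
    have h1 : partialDeriv i (fun y => f (-y)) = (-1 : ℂ) • fun y => partialDeriv i f (-y) := by
      funext y
      have h2 := (differentiable_of_contDiff hf (-y)).hasFDerivAt.comp y
        (hasFDerivAt_id (𝕜 := ℝ) y).neg
      have h3 : fderiv ℝ (fun y => f (-y)) y = _ := h2.fderiv
      rw [partialDeriv, h3]
      simp [partialDeriv]
    rw [h1]
    exact (ih (contDiff_partialDeriv hf i) (h.2 i)).smul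
      ((contDiff_partialDeriv hf i).comp contDiff_neg) _

/-- The leading term of a solution is that of one of the functions `Fmlk`. -/
theorem exists_leading_solution (hn : 1 ≤ n) (hlam : 2 ≤ n → lam ≠ 0)
    (h : fourierTensor m f ∈ kerOmegaK n q s lam) {N : ℕ} (hN : VanishesToOrder N f) :
    VanishesToOrder (N + 1) f ∨ ∃ (l k : ℕ) (p : MvPolynomial (Fin n) ℂ), N = 2 * l + k ∧
      IsAdmissiblePair n lam l k ∧ p ∈ harmonicPoly n k ∧ (m : ZMod 4) = 2 * (k : ZMod 4) + q ∧
      VanishesToOrder (N + 1) (f - solution n s m l k p) := by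
  have hf := contDiff_of_mem h
  obtain ⟨P, hP, hPv⟩ := exists_leading_polynomial hf hN
  rcases eq_or_ne P 0 with rfl | hP0
  · left
    rwa [polyFun_zero, sub_zero] at hPv
  right
  set g := f - polyFun P with hg
  have hgs : ContDiff ℝ ∞ g := hf.sub (contDiff_polyFun P)
  have hrs := contDiff_polyFun (normSqPoly n)
  have hlapg := contDiff_laplacian hgs
  -- The difference of the two sides is homogeneous of degree `N`. By the equation it is made of
  -- remainder terms, of order `N + 1`, and of `‖y‖²` times a multiple of `f`, of order `N + 2`; so
  -- it vanishes.
  have hpoly : normSqPoly n * lapPoly P = (2 * lam) • P := by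
    have hhom : (normSqPoly n * lapPoly P - (2 * lam) • P).IsHomogeneous N := by
      refine IsHomogeneous.sub ?_ (isHomogeneous_smul _ hP)
      -- For `N < 2` the degree `N - 2` is truncated, but then `ΔP = 0` outright.
      rcases Nat.lt_or_ge N 2 with hlt | hge
      · have : lapPoly P = 0 := by
          have hz : ∀ i, pderiv i (pderiv i P) = 0 := by
            intro i
            have h1 : (pderiv i P).IsHomogeneous 0 := by
              have := hP.pderiv (i := i)
              rwa [show N - 1 = 0 by omega] at this
            rw [totalDegree_eq_zero_iff_eq_C.1 ((totalDegree_zero_iff_isHomogeneous _).2 h1),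
              pderiv_C]
          simp [lapPoly, hz]
        rw [this, mul_zero]
        exact isHomogeneous_zero _ _ _
      · have h1 := (isHomogeneous_normSqPoly n).mul (isHomogeneous_lapPoly hP)
        rwa [show 2 + (N - 2) = N by omega] at h1
    rw [← sub_eq_zero]
    refine eq_zero_of_vanishesToOrder hhom ?_
    set ψ : MvPolynomial (Fin n) ℂ := (4 * s ^ 2) • (normSqPoly n) - C (2 * Complex.I * m * s)
      with hψ
    have heq : polyFun (normSqPoly n * lapPoly P - (2 * lam) • P) =
        (2 * lam) • g - polyFun (normSqPoly n) * Laplacian.laplacian g -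
          polyFun (normSqPoly n) * (polyFun ψ * f) := by
      funext y
      have h1 := pde_of_mem h y
      have h2 : Laplacian.laplacian g y = Laplacian.laplacian f y - polyFun (lapPoly P) y := by
        rw [hg, ContDiffAt.laplacian_sub (contDiff_infty.1 hf 2).contDiffAt
          (contDiff_infty.1 (contDiff_polyFun P) 2).contDiffAt, laplacian_polyFun]
      simp only [polyFun_sub, polyFun_mul, polyFun_smul, hψ, polyFun_C, Pi.sub_apply, Pi.mul_apply,
        Pi.smul_apply, smul_eq_mul, h2, polyFun_normSqPoly]
      rw [show g y = f y - polyFun P y from rfl]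
      linear_combination h1
    have hv2 : VanishesToOrder 2 (polyFun (normSqPoly n)) :=
      vanishesToOrder_polyFun (isHomogeneous_normSqPoly n)
    have hψs := contDiff_polyFun ψ
    have c1 : ContDiff ℝ ∞ ((2 * lam) • g) := contDiff_const.smul hgs
    have c2 : ContDiff ℝ ∞ (polyFun (normSqPoly n) * Laplacian.laplacian g) := hrs.mul hlapg
    have c3 : ContDiff ℝ ∞ (polyFun ψ * f) := hψs.mul hf
    have c4 : ContDiff ℝ ∞ (polyFun (normSqPoly n) * (polyFun ψ * f)) := hrs.mul c3
    rw [heq]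
    refine VanishesToOrder.sub (c1.sub c2) c4 (VanishesToOrder.sub c1 c2 (hPv.smul hgs _) ?_) ?_
    · rcases N with _ | N
      · exact (hv2.mul hrs hlapg (N := 0) trivial).mono (by omega)
      · exact (hv2.mul hrs hlapg (N := N) (hPv.laplacian hgs)).mono (by omega)
    · have h5 := VanishesToOrder.mul hψs hf (M := 0) trivial hN
      exact (hv2.mul hrs c3 h5).mono (by omega)
  obtain ⟨l, k, p, hNlk, hp, hPp, hν⟩ := exists_harmonic_of_normSq_mul_lap hn N _ P hP hP0 hpoly
  have hp0 : p ≠ 0 := by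
    rintro rfl
    exact hP0 (by rw [hPp, mul_zero])
  have hlam' : lam = (l : ℂ) * (2 * (l : ℂ) + 2 * (k : ℂ) + (n : ℂ) - 2) :=
    mul_left_cancel₀ two_ne_zero hν
  refine ⟨l, k, p, hNlk, ⟨hlam', fun h2 => ?_, fun h1 => ?_⟩, hp, ?_, ?_⟩
  · by_contra! hl
    have hl0 : l = 0 := by omega
    refine hlam h2 ?_
    rw [hlam', hl0]
    simp
  · subst h1
    exact le_one_of_mem_harmonicPoly_one hp hp0
  -- The leading term inherits the parity of `f`, so `i^{2N} = i^{m-q}`. With `N = 2l + k` this is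
  -- `m ≡ 2k + q` modulo `4`.
  · have hgneg : VanishesToOrder (N + 1)
        (polyFun ((Complex.I ^ (2 * N : ℤ) - Complex.I ^ (m - q.val : ℤ)) • P)) := by
      have hneg : ContDiff ℝ ∞ fun y => g (-y) := hgs.comp contDiff_neg
      have heq : polyFun ((Complex.I ^ (2 * N : ℤ) - Complex.I ^ (m - q.val : ℤ)) • P) =
          Complex.I ^ (m - q.val : ℤ) • g - fun y => g (-y) := by
        funext y
        have h1 := parity_of_mem h y
        have h2 := polyFun_real_smul hP (-1) y
        rw [neg_one_smul] at h2
        push_cast at h2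
        rw [neg_one_pow_eq_I_zpow] at h2
        simp only [polyFun_smul, Pi.smul_apply, Pi.sub_apply, smul_eq_mul, hg, h1, h2]
        ring
      rw [heq]
      exact (hPv.smul hgs _).sub (contDiff_const.smul hgs) hneg (hPv.comp_neg hgs)
    have h1 := eq_zero_of_vanishesToOrder (isHomogeneous_smul _ hP) hgneg
    rw [smul_eq_zero, or_iff_left hP0, sub_eq_zero] at h1
    obtain ⟨c, hc⟩ := dvd_of_I_zpow_eq h1
    rw [zmod_four_iff]
    refine ⟨l - c, ?_⟩
    rw [hNlk] at hc
    push_cast at hc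
    linarith
  · have h1 := vanishesToOrder_solution_sub (s := s) (m := m) (l := l) hn hp
    rw [← hNlk, ← hPp] at h1
    have h2 := hPv.sub hgs ((contDiff_solution hn).sub (contDiff_polyFun P)) h1
    have h3 : f - solution n s m l k p = g - (solution n s m l k p - polyFun P) := by
      rw [hg]
      abel
    rwa [h3]

/-- This bound makes the subtraction process stop. It depends on excluding `l = 0` for `n ≥ 2`,
where every `k` would give `λ = 0`; for `n = 1` the case `l = 0` is harmless because `k ≤ 1`. -/
theorem degree_le_of_isAdmissiblePair (hn : 1 ≤ n) {l k : ℕ} (h : IsAdmissiblePair n lam l k) :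
    ((2 * l + k : ℕ) : ℝ) ≤ ‖lam‖ + 1 := by
  obtain ⟨h1, h2, h3⟩ := h
  have h4 : lam = (((l : ℝ) * (2 * l + 2 * k + n - 2) : ℝ) : ℂ) := by
    rw [h1]
    push_cast
    ring
  have h5 : (l : ℝ) * (2 * l + 2 * k + n - 2) ≤ ‖lam‖ := by
    rw [h4, Complex.norm_real]
    exact le_abs_self _
  push_cast
  have hk0 : (0 : ℝ) ≤ k := Nat.cast_nonneg k
  rcases Nat.lt_or_ge n 2 with hlt | hge
  · have hn1 : n = 1 := by omega
    have hk := h3 hn1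
    rw [hn1] at h5
    rcases Nat.eq_zero_or_pos l with hl | hl
    · have hk1 : (k : ℝ) ≤ 1 := by exact_mod_cast hk
      rw [hl]
      have := norm_nonneg lam
      push_cast
      linarith
    · have hl1 : (1 : ℝ) ≤ l := by exact_mod_cast hl
      push_cast at h5
      nlinarith
  · have hl1 : (1 : ℝ) ≤ l := by exact_mod_cast h2 hge
    have hn2 : (2 : ℝ) ≤ n := by exact_mod_cast hge
    nlinarith

/-- The functions `Fmlk` lying in the kernel. -/
def generators (n : ℕ) (q : ZMod 4) (s lam : ℂ) : Set (Fn n) :=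
  {F | ∃ (m : ℤ) (l k : ℕ) (h : MvPolynomial (Fin n) ℂ), IsAdmissiblePair n lam l k ∧
    h ∈ harmonicPoly n k ∧ (m : ZMod 4) = 2 * (k : ZMod 4) + q ∧ F = Fmlk n s m l k h}

/-- The number `d` counts the orders left before `N` exceeds `‖λ‖ + 1`. Beyond that no leading term
is possible, so the order of vanishing increases without end and the function is flat, hence zero.
-/
theorem fourierTensor_mem_span (hn : 1 ≤ n) (hlam : 2 ≤ n → lam ≠ 0) (d : ℕ) :
    ∀ (N : ℕ) (f : EuclideanSpace ℝ (Fin n) → ℂ), ‖lam‖ + 1 < N + d →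
      fourierTensor m f ∈ kerOmegaK n q s lam → VanishesToOrder N f →
      fourierTensor m f ∈ Submodule.span ℂ (generators n q s lam) := by
  induction d with
  | zero =>
    intro N f hN hf hv
    have hall : ∀ j, VanishesToOrder (N + j) f := by
      intro j
      induction j with
      | zero => exact hv
      | succ j ih =>
        refine (exists_leading_solution hn hlam hf ih).resolve_right ?_
        rintro ⟨l, k, p, hNlk, hpair, -⟩
        have h1 := degree_le_of_isAdmissiblePair hn hpair
        rw [← hNlk] at h1
        push_cast at h1 hN
        have : (0 : ℝ) ≤ j := Nat.cast_nonneg j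
        linarith
    have h0 := eq_zero_of_mem_of_flat hn hf fun M => (hall M).mono (by omega)
    have h1 : fourierTensor m f = 0 := by
      rw [h0]
      funext p
      simp [fourierTensor]
    rw [h1]
    exact Submodule.zero_mem _
  | succ d ih =>
    intro N f hN hf hv
    have hN' : ‖lam‖ + 1 < ((N + 1 : ℕ) : ℝ) + d := by
      push_cast at hN ⊢
      linarith
    rcases exists_leading_solution hn hlam hf hv with h | ⟨l, k, p, hNlk, hpair, hp, hm, h⟩
    · exact ih (N + 1) f hN' hf h
    · have hgen : Fmlk n s m l k p ∈ Submodule.span ℂ (generators n q s lam) :=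
        Submodule.subset_span ⟨m, l, k, p, hpair, hp, hm, rfl⟩
      have hker : fourierTensor m (f - solution n s m l k p) ∈ kerOmegaK n q s lam := by
        rw [fourierTensor_sub, ← Fmlk_eq]
        exact Submodule.sub_mem _ hf (Fmlk_mem_kerOmegaK hn hpair hp hm)
      have h1 := Submodule.add_mem _ (ih (N + 1) _ hN' hker h) hgen
      rwa [fourierTensor_sub, ← Fmlk_eq, sub_add_cancel] at h1

/-- Admissibility of `λ` plays no role here: without it there are no generators and the kernel is
zero. -/
theorem kerOmegaK_eq_span (hn : 1 ≤ n) (hlam : 2 ≤ n → lam ≠ 0) :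
    kerOmegaK n q s lam = Submodule.span ℂ (generators n q s lam) := by
  refine le_antisymm (fun F hF => ?_) (Submodule.span_le.2 ?_)
  · rw [eq_sum_fourierTensor hF.1.1 hF.2]
    refine Submodule.sum_mem _ fun m _ => ?_
    obtain ⟨d, hd⟩ := exists_nat_gt (‖lam‖ + 1)
    exact fourierTensor_mem_span hn hlam d 0 _ (by simpa using hd)
      (kSpan_le_kerOmegaK hF (fourierTensor_component_mem hF.1.1 hF.2 m)) trivial
  · rintro _ ⟨m, l, k, h, hpair, hh, hm, rfl⟩
    exact Fmlk_mem_kerOmegaK hn hpair hh hm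

/-- If the function were zero, its leading polynomial `‖y‖^{2l} h` would be zero too, which is
impossible in a domain. -/
theorem Fmlk_ne_zero (hn : 1 ≤ n) {l k : ℕ} {h : MvPolynomial (Fin n) ℂ}
    (hh : h ∈ harmonicPoly n k) (h0 : h ≠ 0) : Fmlk n s m l k h ≠ 0 := by
  intro hF
  rw [Fmlk_eq] at hF
  have h1 : solution n s m l k h = 0 := by
    refine fourierTensor_injective (m := m) (hF.trans ?_)
    funext p
    simp [fourierTensor]
  have h2 := vanishesToOrder_solution_sub (s := s) (m := m) (l := l) hn hh
  rw [h1, zero_sub] at h2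
  have hc : ContDiff ℝ ∞ (-polyFun (normSqPoly n ^ l * h)) := (contDiff_polyFun _).neg
  have h3 := h2.smul hc (-1)
  rw [smul_neg, neg_smul, one_smul, neg_neg] at h3
  have h4 := eq_zero_of_vanishesToOrder (isHomogeneous_pow_mul hh) h3
  exact (mul_ne_zero (pow_ne_zero l (normSqPoly_ne_zero hn)) h0) h4

/-- Powers of an isotropic linear form are harmonic. -/
theorem isotropic_pow_mem_harmonicPoly (a : Fin n → ℂ) (ha : ∑ i, a i ^ 2 = 0) (k : ℕ) :
    (∑ i, C (a i) * X i) ^ k ∈ harmonicPoly n k := by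
  classical
  set z : MvPolynomial (Fin n) ℂ := ∑ i, C (a i) * X i with hz
  have hz1 : z.IsHomogeneous 1 := IsHomogeneous.sum _ _ _ fun i _ => isHomogeneous_C_mul_X _ _
  have hd : ∀ i, pderiv i z = C (a i) := by
    intro i
    simp [hz, pderiv_X, Pi.single_apply]
  refine ⟨by simpa using hz1.pow k, ?_⟩
  have h1 : ∀ i, pderiv i (pderiv i (z ^ k)) =
      ((k : MvPolynomial (Fin n) ℂ) * ((k - 1 : ℕ) : MvPolynomial (Fin n) ℂ) * z ^ (k - 1 - 1)) *
        C (a i ^ 2) := by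
    intro i
    have h2 : pderiv i (k : MvPolynomial (Fin n) ℂ) = 0 := Derivation.map_natCast _ k
    simp only [Derivation.leibniz_pow, hd, Derivation.leibniz, pderiv_C, smul_eq_mul,
      nsmul_eq_mul, map_pow, h2]
    ring
  simp only [h1]
  rw [← Finset.mul_sum, ← map_sum, ha, map_zero, mul_zero]

theorem exists_harmonicPoly_ne_zero (hn : 1 ≤ n) {k : ℕ} (hk : n = 1 → k ≤ 1) :
    ∃ h ∈ harmonicPoly n k, h ≠ 0 := by
  classical
  rcases Nat.lt_or_ge n 2 with hlt | hge
  · have hk1 := hk (by omega)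
    interval_cases k
    · exact ⟨1, ⟨isHomogeneous_one _ _, by simp⟩, one_ne_zero⟩
    · refine ⟨X ⟨0, hn⟩, ⟨isHomogeneous_X _ _, ?_⟩, X_ne_zero _⟩
      refine Finset.sum_eq_zero fun i _ => ?_
      rw [pderiv_X, Pi.single_apply]
      split_ifs <;> simp
  -- The isotropic form `X₀ + i X₁`, available once there are two variables; its powers are harmonic
  -- and nonzero.
  · set a : Fin n → ℂ := Pi.single ⟨0, by omega⟩ 1 + Pi.single ⟨1, hge⟩ Complex.I with ha
    have hne : (⟨0, by omega⟩ : Fin n) ≠ ⟨1, hge⟩ := by simp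
    have hsq : ∀ i, a i ^ 2 = (if i = ⟨0, by omega⟩ then 1 else 0) +
        (if i = ⟨1, hge⟩ then -1 else 0) := by
      intro i
      simp only [ha, Pi.add_apply, Pi.single_apply]
      by_cases h0 : i = ⟨0, by omega⟩
      · rw [if_pos h0, if_neg (h0 ▸ hne), if_neg (h0 ▸ hne)]
        ring
      · by_cases h1 : i = ⟨1, hge⟩
        · rw [if_neg h0, if_pos h1, if_pos h1]
          simp
        · rw [if_neg h0, if_neg h1, if_neg h1]
          ring
    refine ⟨_, isotropic_pow_mem_harmonicPoly a ?_ k, pow_ne_zero k fun h => ?_⟩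
    · simp only [hsq, Finset.sum_add_distrib, Finset.sum_ite_eq', Finset.mem_univ, if_true]
      ring
    · have h1 := congrArg (MvPolynomial.eval (Pi.single (⟨0, by omega⟩ : Fin n) (1 : ℂ))) h
      simp [Pi.single_apply, ha] at h1

/-- For `n ≥ 2` put `j = l + k - 1`, so that `k ≥ 0` becomes `l ≤ j + 1`. For `n = 1` put `L = 2l +
k`, where `k` is the parity of `L`. The converse inverts these substitutions. -/
theorem mem_admissibleSet_of_isAdmissiblePair (hn : 1 ≤ n) {l k : ℕ}
    (h : IsAdmissiblePair n lam l k) : lam ∈ admissibleSet n := by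
  obtain ⟨h1, h2, h3⟩ := h
  unfold admissibleSet
  split_ifs with hn1
  · refine ⟨2 * l + k, ?_⟩
    have hk := h3 hn1
    rw [h1, hn1]
    interval_cases k <;> push_cast <;> ring
  · refine ⟨l, l + k - 1, by exact_mod_cast h2 (by omega), by omega, ?_⟩
    rw [h1]
    push_cast
    ring

theorem exists_isAdmissiblePair (h : lam ∈ admissibleSet n) :
    ∃ l k, IsAdmissiblePair n lam l k := by
  unfold admissibleSet at h
  split_ifs at h with hn1
  · obtain ⟨L, hL⟩ := h
    refine ⟨L / 2, L % 2, ?_, by omega, fun _ => by omega⟩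
    have h1 : (L : ℂ) = 2 * ((L / 2 : ℕ) : ℂ) + ((L % 2 : ℕ) : ℂ) := by
      exact_mod_cast (Nat.div_add_mod L 2).symm
    rw [hL, hn1]
    rcases Nat.mod_two_eq_zero_or_one L with h2 | h2 <;> rw [h1, h2] <;> push_cast <;> ring
  · obtain ⟨l, j, hl, hlj, hL⟩ := h
    refine ⟨l.toNat, (j + 1 - l).toNat, ?_, fun _ => by omega, fun h => absurd h hn1⟩
    have h1 : ((l.toNat : ℕ) : ℂ) = (l : ℂ) := by
      exact_mod_cast congrArg (Int.cast : ℤ → ℂ) (Int.toNat_of_nonneg (by omega : 0 ≤ l))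
    have h2 : (((j + 1 - l).toNat : ℕ) : ℂ) = (j : ℂ) + 1 - l := by
      exact_mod_cast congrArg (Int.cast : ℤ → ℂ)
        (Int.toNat_of_nonneg (by omega : 0 ≤ j + 1 - l))
    rw [h1, h2, hL]
    ring

end Kernel

end SingularSchrodinger

end

/-! ### The main theorem. -/

theorem mainTheorem2 (n : ℕ) (hn : 1 ≤ n) (q : ZMod 4) (s lam : ℂ)
    (hlam : 2 ≤ n → lam ≠ 0) :
    (SingularSchrodinger.kerOmegaK n q s lam ≠ ⊥ ↔
      lam ∈ SingularSchrodinger.admissibleSet n) ∧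
    (lam ∈ SingularSchrodinger.admissibleSet n →
      SingularSchrodinger.kerOmegaK n q s lam =
        Submodule.span ℂ {F : SingularSchrodinger.Fn n |
          ∃ (m : ℤ) (l k : ℕ) (h : MvPolynomial (Fin n) ℂ),
            SingularSchrodinger.IsAdmissiblePair n lam l k ∧
            h ∈ SingularSchrodinger.harmonicPoly n k ∧
            (m : ZMod 4) = 2 * (k : ZMod 4) + q ∧
            F = SingularSchrodinger.Fmlk n s m l k h}) := by
  have hspan := SingularSchrodinger.kerOmegaK_eq_span (q := q) (s := s) hn hlam
  refine ⟨⟨fun hne => ?_, fun hadm hbot => ?_⟩, fun _ => hspan⟩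
  -- The span description holds for every `λ` allowed here; for an inadmissible one the generating
  -- set is empty.
  · by_contra hadm
    refine hne (hspan.trans ?_)
    rw [Submodule.span_eq_bot]
    rintro F ⟨m, l, k, h, hpair, -⟩
    exact absurd (SingularSchrodinger.mem_admissibleSet_of_isAdmissiblePair hn hpair) hadm
  · obtain ⟨l, k, hpair⟩ := SingularSchrodinger.exists_isAdmissiblePair hadm
    obtain ⟨h, hh, h0⟩ := SingularSchrodinger.exists_harmonicPoly_ne_zero hn hpair.2.2
    have hm : (((2 * k + q.val : ℤ) : ℤ) : ZMod 4) = 2 * (k : ZMod 4) + q := by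
      push_cast
      simp
    have hmem := SingularSchrodinger.Fmlk_mem_kerOmegaK (s := s) hn hpair hh hm
    rw [hbot, Submodule.mem_bot] at hmem
    exact SingularSchrodinger.Fmlk_ne_zero hn hh h0 hmem
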